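/- Let $f:\mathbb{R}\to\mathbb{R}$ be piecewise smooth: $\mathbb{R}$ is a finite disjoint union of intervals, on each of which $f$ is continuously differentiable and either strictly monotone or constant. Let $Z\sim\mathcal N(0,1)$ and assume that the entropy $H(\lfloor f(Z)\rfloor)$ is finite. The information dimension of a real random variable $X$ is $d(X)=\lim_{M\to\infty}H(\lfloor MX\rfloor/M)/\log M$, if this limit exists. *State evolution.* For $v\in(0,1]$ let $$\mathsf{mmse}_z(v)=\mathbb{E}\Big[\big(Z-\mathbb{E}[Z\mid \sqrt{v^{-1}-1}\,Z+N,\;f(Z)]\big)^2\Big],\qquad \phi(v)=\Big(\frac1{\mathsf{mmse}_z(v)}-\frac1v\Big)^{-1}\in[0,\infty],$$ where $N\sim\mathcal N(0,1)$ is independent of $Z$, and $\phi(0)=\lim_{v\to0+}\phi(v)$. An eigenvalue distribution is a probability measure $P_\lambda$ whose support is a compact subset of $(0,\infty)$; it is understood up to scale, and at sampling ratio $\delta>1$ it is normalized by a scale factor so that $\mathbb{E}[\lambda]=\delta$. With this normalization let $$\Phi(v)=\Big(\frac{1}{\frac1\delta\,\mathbb{E}\left[\frac{v\lambda}{v+\lambda}\right]}-\frac1v\Big)^{-1},\qquad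 \mathsf{MSE}_\lambda(v)=\mathbb{E}\Big[\frac{v}{v+\lambda}\Big]\qquad(v\in[0,\infty]),$$ where $v=0$ and $v=\infty$ are understood as limits. Put $V_r^{-1}=1$, $V_l^t=\phi(V_r^{t-1})$ and $V_r^t=\Phi(V_l^t)$ for $t\ge0$, let $V_r^\star=\lim_{t\to\infty}V_r^t$, and let $\mathsf{MSE}^\star_\lambda=\mathsf{MSE}_\lambda(\phi(V_r^\star))$ be the predicted final mean squared error. The perfect recovery threshold is $$\delta^{\mathsf p}_\lambda=\inf\{\delta>1:\ \mathsf{MSE}^\star_\lambda=0\}\in[1,\infty].$$ *Lorenz order.* For a nonnegative random variable with distribution function $F$, let $F^{-1}(y)=\sup\{x:F(x)\le y\}$ for $0<y<1$, and let $L(u)=\int_0^uF^{-1}(y)\,dy\big/\int_0^1F^{-1}(y)\,dy$ for $0\le u\le1$. Then $\lambda_1$ is spikier than $\lambda_2$, written $\lambda_1\succeq_L\lambda_2$, if $L_{\lambda_1}(u)\le L_{\lambda_2}(u)$ for all $u\in[0,1]$. **Theorem.** (i) For all eigenvalue distributions, if $\lambda_1\succeq_L\lambda_2$, then $\delta^{\mathsf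 p}_{\lambda_1}\le\delta^{\mathsf p}_{\lambda_2}$. (ii) Assume in addition that $f'\neq0$ almost everywhere on the intervals on which $f$ is strictly monotone. Then $d(f(Z))$ exists. If moreover $\mathsf{mmse}_z(1)<1$ and $\delta^{\mathsf p}_{\mathrm{opt}}:=1/d(f(Z))<\infty$, then for every $\varepsilon>0$ there is an eigenvalue distribution, which can be chosen with exactly two atoms and no other mass, such that $$\delta^{\mathsf p}_{\mathrm{opt}}\le\delta^{\mathsf p}_\lambda<\delta^{\mathsf p}_{\mathrm{opt}}+\varepsilon .$$ -/

import Mathlib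

open MeasureTheory ProbabilityTheory Set Filter Topology
open scoped ENNReal

noncomputable section

namespace GLMEP

/-! ### Entropy and information dimension -/

/-- Shannon entropy of an integer-valued random variable with law `ρ`, with values in `[0, ∞]`. -/
def entropy (ρ : Measure ℤ) : ℝ≥0∞ :=
  ∑' k : ℤ, ENNReal.ofReal (Real.negMulLog (ρ.real {k}))

/-- Law of `⌊M X⌋` when `X` has law `μ`. It has the same entropy as the quantization
`⌊M X⌋ / M`, because division by `M` is injective on the integers. -/
def quantizedLaw (μ : Measure ℝ) (M : ℕ) : Measure ℤ :=
  μ.map (fun x : ℝ => ⌊(M : ℝ) * x⌋)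

/-- The information dimension of a real random variable with law `μ` exists and equals `d`. -/
def HasInfoDim (μ : Measure ℝ) (d : ℝ≥0∞) : Prop :=
  Tendsto (fun M : ℕ => entropy (quantizedLaw μ M) / ENNReal.ofReal (Real.log (M : ℝ)))
    atTop (𝓝 d)

/-! ### Conditions on the nonlinearity -/

/-- `ℝ` is a finite disjoint union of intervals, on each of which `f` is continuously
differentiable and either strictly monotone or constant. -/
def PiecewiseSmooth (f : ℝ → ℝ) : Prop :=
  ∃ (K : ℕ) (I : Fin K → Set ℝ),
    (∀ k, (I k).OrdConnected) ∧
    Pairwise (fun j k => Disjoint (I j) (I k)) ∧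
    (⋃ k, I k) = univ ∧
    ∀ k, ContDiffOn ℝ 1 f (I k) ∧
      (StrictMonoOn f (I k) ∨ StrictAntiOn f (I k) ∨ ∃ c, ∀ x ∈ I k, f x = c)

/-- For almost every `x`: if `f' x = 0` then `f` is constant near `x`. For a piecewise smooth `f`
this says that `f' ≠ 0` almost everywhere on the intervals of strict monotonicity, i.e. that
`f(Z)` has an absolutely continuous law outside of the flat sections of `f`. -/
def NonflatRegular (f : ℝ → ℝ) : Prop :=
  ∀ᵐ x : ℝ, deriv f x = 0 → ∀ᶠ y in 𝓝 x, f y = f x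

/-! ### Minimum mean squared errors -/

/-- `mmse(Z, snr | U) = 𝔼 (Z - 𝔼[Z | √snr Z + N, U])²` for random variables `Z`, `U` on `(Ω, μ)`
and a standard Gaussian `N` independent of `(Z, U)`, realised as the second coordinate of
`Ω × ℝ`. -/
def condMMSE {Ω : Type*} [MeasurableSpace Ω] (μ : Measure Ω) (Z U : Ω → ℝ) (snr : ℝ) : ℝ :=
  ∫ ω : Ω × ℝ, (Z ω.1 -
    condExp
      (MeasurableSpace.comap (fun ω' : Ω × ℝ => (√snr * Z ω'.1 + ω'.2, U ω'.1)) inferInstance)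
      (μ.prod (gaussianReal 0 1)) (fun ω' : Ω × ℝ => Z ω'.1) ω) ^ 2 ∂(μ.prod (gaussianReal 0 1))

/-- `mmse_z(v) = mmse(Z, v⁻¹ - 1 | f(Z))` with `Z` standard Gaussian; used for `v ∈ (0, 1]`. -/
def mmseZ (f : ℝ → ℝ) (v : ℝ≥0∞) : ℝ≥0∞ :=
  ENNReal.ofReal (condMMSE (gaussianReal 0 1) id f (v.toReal⁻¹ - 1))

/-! ### Eigenvalue distributions -/

/-- Probability measures with compact support contained in `(0, ∞)`. -/
def IsEigenvalueLaw (ν : Measure ℝ) : Prop :=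
  IsProbabilityMeasure ν ∧ ∃ a b : ℝ, 0 < a ∧ ν (Icc a b)ᶜ = 0

/-- The eigenvalue distribution `ν` rescaled to have mean `δ`. -/
def spectrumAt (ν : Measure ℝ) (δ : ℝ) : Measure ℝ :=
  ν.map (fun x : ℝ => δ / (∫ y, y ∂ν) * x)

/-! ### State evolution

The variances take values in `[0, ∞]`, where `0⁻¹ = ∞` and `∞⁻¹ = 0`. -/

/-- `φ(v) = (1 / mmse_z(v) - 1 / v)⁻¹` for `v ∈ (0, 1]`, and `φ(0) = lim_{v → 0+} φ(v)` (the
limit exists because `φ` is nondecreasing on `(0, 1]`). -/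
def phi (f : ℝ → ℝ) (v : ℝ≥0∞) : ℝ≥0∞ :=
  if v = 0 then limsup (fun u : ℝ≥0∞ => ((mmseZ f u)⁻¹ - u⁻¹)⁻¹) (𝓝[>] 0)
  else ((mmseZ f v)⁻¹ - v⁻¹)⁻¹

/-- `Φ(v) = (1 / (δ⁻¹ 𝔼[v λ / (v + λ)]) - 1 / v)⁻¹` for `λ` of law `P`, with `Φ(0) = 0`. The
integrand is written as `(1 / v + 1 / λ)⁻¹`, which has the correct value `λ` at `v = ∞`. -/
def Phi (P : Measure ℝ) (δ : ℝ) (v : ℝ≥0∞) : ℝ≥0∞ :=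
  if v = 0 then 0
  else (((ENNReal.ofReal δ)⁻¹ * ∫⁻ x, (v⁻¹ + (ENNReal.ofReal x)⁻¹)⁻¹ ∂P)⁻¹ - v⁻¹)⁻¹

/-- `MSE_λ(v) = 𝔼[v / (v + λ)]` for `λ` of law `P`. The integrand is written as
`(1 + λ / v)⁻¹`, which has the correct value `1` at `v = ∞`. -/
def mse (P : Measure ℝ) (v : ℝ≥0∞) : ℝ≥0∞ :=
  ∫⁻ x, (1 + ENNReal.ofReal x / v)⁻¹ ∂P

/-- The sequence `V_r` of the state evolution at sampling ratio `δ`, started at `1`: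
`V_l^t = φ(V_r^{t-1})` and `V_r^t = Φ(V_l^t)`. The index is shifted: `seVr f ν δ t` is
`V_r^{t-1}`. The eigenvalue distribution is normalized to have mean `δ`. -/
def seVr (f : ℝ → ℝ) (ν : Measure ℝ) (δ : ℝ) : ℕ → ℝ≥0∞
  | 0 => 1
  | t + 1 => Phi (spectrumAt ν δ) δ (phi f (seVr f ν δ t))

/-- The limit `V_r^⋆` of the sequence `V_r` (which is nonincreasing for `δ > 1`, so that its upper
limit is its limit). -/
def vrStar (f : ℝ → ℝ) (ν : Measure ℝ) (δ : ℝ) : ℝ≥0∞ :=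
  limsup (seVr f ν δ) atTop

/-- The final mean squared error `MSE^⋆ = MSE_λ(φ(V_r^⋆))` predicted by the state evolution. -/
def mseStar (f : ℝ → ℝ) (ν : Measure ℝ) (δ : ℝ) : ℝ≥0∞ :=
  mse (spectrumAt ν δ) (phi f (vrStar f ν δ))

/-- The perfect recovery threshold: the infimum (`∞` if there is none) of the sampling ratios
`δ > 1` at which the predicted final mean squared error is zero. -/
def threshold (f : ℝ → ℝ) (ν : Measure ℝ) : ℝ≥0∞ :=
  sInf (ENNReal.ofReal '' {δ : ℝ | 1 < δ ∧ mseStar f ν δ = 0})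

/-! ### Lorenz order -/

/-- The quantile function `F⁻¹(y) = sup {x | F(x) ≤ y}`, `0 < y < 1`. -/
def quantile (ν : Measure ℝ) (y : ℝ) : ℝ :=
  sSup {x : ℝ | cdf ν x ≤ y}

/-- The Lorenz curve. -/
def lorenz (ν : Measure ℝ) (u : ℝ) : ℝ :=
  (∫ y in (0 : ℝ)..u, quantile ν y) / ∫ y in (0 : ℝ)..1, quantile ν y

/-- `ν₁` is spikier than `ν₂` in the Lorenz order. -/
def Spikier (ν₁ ν₂ : Measure ℝ) : Prop :=
  ∀ u ∈ Icc (0 : ℝ) 1, lorenz ν₁ u ≤ lorenz ν₂ u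

end GLMEP

end

noncomputable section

namespace GLMEP

/-! Write ρ for the Gaussian mass of `flatSet f`, the open set on which `f` is locally constant.

Everything rests on the monotonicity of the two state evolution maps. A Gaussian observation at
signal-to-noise ratio s + Δ carries the same information as two observations with independent
noises, at ratios s and Δ. Mixing an estimator based on the first with the second observation, in
proportions 1 - c and c, gives mmse(s + Δ) ≤ (1 - c)² mmse(s) + c²/Δ. The best c yields 1/mmse(s +
Δ) ≥ 1/mmse(s) + Δ, which says that φ is nondecreasing on [0, 1] (`phi_mono`). The same variational
inequality for (1/v + 1/λ)⁻¹, averaged over the spectrum, shows that Φ is nondecreasing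
(`Phi_mono`).

Part (i): x ↦ x / (1 + w x) is concave, so among spectra of equal mean a spikier one has the smaller
average, hence the smaller Φ (`Phi_le_of_spikier`). By induction its whole state evolution is
smaller. The final error vanishes exactly when φ(V_r^⋆) = 0, so every sampling ratio that is good
for the less spiky spectrum is good for the spikier one.

Part (ii): in rotated coordinates Z = √(1-v) A + √v W, where A is observed and W is an independent
standard Gaussian. For small v, f(Z) says nothing about W when A lies in a flat section, and reveals
Z otherwise. Hence mmse_z(v) is of order ρ v (`exists_le_mmseZ`, `exists_mmseZ_le`), and φ behaves
near 0 like κ v with κ = ρ / (1 - ρ). On the other side Φ(x) ≤ x / (δ - 1), with asymptotic equality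
at 0 whatever the spectrum. The two slopes balance at δ = 1 / (1 - ρ). Below this value the iterates
stay above a positive floor (`mseStar_ne_zero`). Above it, 0 attracts a neighbourhood whose size
depends on f and δ but not on the spectrum (`mseStar_eq_zero`), and a sufficiently spiky two-atom
spectrum sends the first iterate into that neighbourhood (`exists_twoAtoms_seVr_le`).

Finally f(Z) is a mixture of an absolutely continuous part of mass 1 - ρ and finitely many atoms, so
Rényi's theorem (`hasInfoDim_add`) gives d(f(Z)) = 1 - ρ. -/

/-- The standard Gaussian law on `ℝ`. -/
abbrev gauss : Measure ℝ := gaussianReal 0 1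

/-! ### Gaussian integrals and reflection invariance -/

theorem lintegral_gauss_sq : ∫⁻ w, ENNReal.ofReal (w ^ 2) ∂gauss = 1 := by
  have h := variance_fun_id_gaussianReal (μ := 0) (v := 1)
  rw [variance_eq_integral (by fun_prop)] at h
  simp only [integral_id_gaussianReal, sub_zero] at h
  rw [← ofReal_integral_eq_lintegral_ofReal, h]
  · simp
  · exact (IsGaussian.memLp_two_id (μ := gauss)).integrable_sq
  · exact Eventually.of_forall fun x => sq_nonneg x

theorem lintegral_gauss_sub_sq (x c : ℝ) :
    ∫⁻ w, ENNReal.ofReal ((x - c * w) ^ 2) ∂gauss = ENNReal.ofReal (x ^ 2 + c ^ 2) := by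
  have h2 : Integrable (fun w : ℝ => w ^ 2) gauss :=
    (IsGaussian.memLp_two_id (μ := gauss)).integrable_sq
  have h1 : Integrable (fun w : ℝ => w) gauss := IsGaussian.integrable_id (μ := gauss)
  have hv : ∫ w, w ^ 2 ∂gauss = 1 := by
    have h := variance_fun_id_gaussianReal (μ := 0) (v := 1)
    rw [variance_eq_integral (by fun_prop)] at h
    simpa using h
  have e : (fun w : ℝ => (x - c * w) ^ 2) =
      fun w => (x ^ 2 + (-2 * x * c) * w) + c ^ 2 * w ^ 2 := by
    funext w; ring
  have hi : Integrable (fun w : ℝ => x ^ 2 + (-2 * x * c) * w) gauss :=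
    (integrable_const _).add (h1.const_mul _)
  rw [← ofReal_integral_eq_lintegral_ofReal]
  · congr 1
    rw [e, integral_add hi (h2.const_mul _), integral_add (integrable_const _) (h1.const_mul _),
      integral_const_mul, integral_const_mul, hv, integral_id_gaussianReal]
    simp
  · rw [e]; exact hi.add (h2.const_mul _)
  · exact Eventually.of_forall fun w => sq_nonneg _

/-- Invariance of the standard Gaussian law on the plane under reflections. -/
theorem lintegral_gauss_prod_reflection {a b : ℝ} (h : a ^ 2 + b ^ 2 = 1) {F : ℝ × ℝ → ℝ≥0∞}
    (hF : Measurable F) :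
    ∫⁻ p, F (a * p.1 + b * p.2, b * p.1 - a * p.2) ∂(gauss.prod gauss) =
      ∫⁻ p, F p ∂(gauss.prod gauss) := by
  obtain ⟨θ, hc, hs⟩ : ∃ θ : ℝ, Real.cos θ = a ∧ Real.sin θ = b := by
    have hz : ‖(⟨a, b⟩ : ℂ)‖ = 1 := by
      rw [Complex.norm_eq_sqrt_sq_add_sq]; simp [h]
    have hne : (⟨a, b⟩ : ℂ) ≠ 0 := by
      intro h0; rw [h0] at hz; simp at hz
    refine ⟨Complex.arg ⟨a, b⟩, ?_, ?_⟩
    · rw [Complex.cos_arg hne, hz]; simp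
    · rw [Complex.sin_arg, hz]; simp
  -- The reflection is the rotation by θ followed by a sign change of the second coordinate; each
  -- preserves the product law.
  have hrot := IsGaussian.map_rotation_eq_self (μ := gauss) (by simp) θ
  have hneg : Measure.map (Prod.map id (fun x : ℝ => -x)) (gauss.prod gauss)
      = gauss.prod gauss := by
    rw [← Measure.map_prod_map _ _ measurable_id measurable_neg, gaussianReal_map_neg]
    simp
  have hm : Measurable (Prod.map id (fun x : ℝ => -x) : ℝ × ℝ → ℝ × ℝ) :=
    measurable_id.prodMap measurable_neg
  conv_rhs => rw [← hneg, lintegral_map hF hm, ← hrot]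
  refine Eq.trans ?_ (lintegral_map (hF.comp hm)
    (ContinuousLinearMap.continuous (ContinuousLinearMap.rotation θ)).measurable).symm
  refine lintegral_congr fun p => ?_
  simp only [Function.comp, ContinuousLinearMap.rotation_apply, Prod.map, hc, hs, smul_eq_mul, id]
  congr 2
  ring

/-! ### Estimators and the minimum mean squared error -/

/-- The conditional expectation is the best approximation in mean square. -/
theorem integral_sub_condExp_sq_le {Ω : Type*} {m m₀ : MeasurableSpace Ω} {μ : Measure[m₀] Ω}
    [IsProbabilityMeasure μ] (hm : m ≤ m₀) {X Y : Ω → ℝ} (hX : MemLp X 2 μ)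
    (hY : StronglyMeasurable[m] Y) (hY2 : MemLp Y 2 μ) :
    ∫ ω, (X ω - (μ[X | m]) ω) ^ 2 ∂μ ≤ ∫ ω, (X ω - Y ω) ^ 2 ∂μ := by
  have hE : MemLp (μ[X | m]) 2 μ := hX.condExp (by norm_num)
  set E := μ[X | m] with hEdef
  have hD : MemLp (E - Y) 2 μ := hE.sub hY2
  have hDm : StronglyMeasurable[m] (E - Y) := stronglyMeasurable_condExp.sub hY
  have hDX : Integrable ((E - Y) * X) μ := hD.integrable_mul hX
  have hDE : Integrable ((E - Y) * E) μ := hD.integrable_mul hE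
  have hX1 : Integrable X μ := hX.integrable (by norm_num)
  -- Orthogonality: E - Y is measurable for the smaller σ-algebra, so X - E is orthogonal to it and
  -- the cross term of the square drops out.
  have key : ∫ ω, ((E - Y) * X) ω ∂μ = ∫ ω, ((E - Y) * E) ω ∂μ := by
    rw [← integral_condExp hm (f := (E - Y) * X)]
    exact integral_congr_ae (condExp_mul_of_stronglyMeasurable_left hDm hDX hX1)
  have hXE : Integrable (fun ω => (X ω - E ω) ^ 2) μ := (hX.sub hE).integrable_sq
  have hD2 : Integrable (fun ω => (E ω - Y ω) ^ 2) μ := hD.integrable_sq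
  have e : (fun ω => (X ω - Y ω) ^ 2) = fun ω =>
      ((X ω - E ω) ^ 2 + (E ω - Y ω) ^ 2) +
        2 * (((E - Y) * X) ω - ((E - Y) * E) ω) := by
    funext ω; simp only [Pi.mul_apply, Pi.sub_apply]; ring
  have hs : Integrable (fun ω => (X ω - E ω) ^ 2 + (E ω - Y ω) ^ 2) μ := hXE.add hD2
  have hs' : Integrable (fun ω => 2 * (((E - Y) * X) ω - ((E - Y) * E) ω)) μ :=
    (hDX.sub hDE).const_mul 2
  rw [e, integral_add hs hs', integral_add hXE hD2, integral_const_mul,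
    integral_sub hDX hDE, key]
  have : 0 ≤ ∫ ω, (E ω - Y ω) ^ 2 ∂μ := integral_nonneg fun ω => sq_nonneg _
  linarith

/-- Mean squared error of the estimator `g(√s Z + N, f(Z))` of a standard Gaussian `Z`. -/
def estRisk (f : ℝ → ℝ) (s : ℝ) (g : ℝ × ℝ → ℝ) : ℝ≥0∞ :=
  ∫⁻ p : ℝ × ℝ, ENNReal.ofReal ((p.1 - g (√s * p.1 + p.2, f p.1)) ^ 2) ∂(gauss.prod gauss)

theorem memLp_fst_gauss_prod : MemLp (fun p : ℝ × ℝ => p.1) 2 (gauss.prod gauss) :=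
  (IsGaussian.memLp_two_id (μ := gauss)).comp_fst gauss

/-- With `exists_estRisk_eq_condMMSE` this replaces conditional expectations by explicit measurable
estimators: upper bounds come from exhibiting one, lower bounds from analysing an optimal one. -/
theorem condMMSE_le_estRisk {f : ℝ → ℝ} (hf : Measurable f) (s : ℝ) {g : ℝ × ℝ → ℝ}
    (hg : Measurable g) : ENNReal.ofReal (condMMSE gauss id f s) ≤ estRisk f s g := by
  have hT : Measurable (fun p : ℝ × ℝ => (√s * p.1 + p.2, f p.1)) := by fun_prop
  have hgT : Measurable (fun p : ℝ × ℝ => g (√s * p.1 + p.2, f p.1)) := hg.comp hT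
  -- Square integrability of the estimator is not assumed: it follows from finiteness of the risk,
  -- and an infinite risk makes the bound trivial.
  by_cases htop : estRisk f s g = ⊤
  · rw [htop]; exact le_top
  have hsub : MemLp (fun p : ℝ × ℝ => p.1 - g (√s * p.1 + p.2, f p.1)) 2 (gauss.prod gauss) := by
    rw [memLp_two_iff_integrable_sq (by fun_prop)]
    refine ⟨by fun_prop, ?_⟩
    rw [hasFiniteIntegral_iff_ofReal (Eventually.of_forall fun p => sq_nonneg _)]
    exact lt_top_iff_ne_top.2 htop
  have hY2 : MemLp (fun p : ℝ × ℝ => g (√s * p.1 + p.2, f p.1)) 2 (gauss.prod gauss) := by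
    have := memLp_fst_gauss_prod.sub hsub
    refine this.congr_norm hgT.aestronglyMeasurable (Eventually.of_forall fun p => ?_)
    simp
  have := integral_sub_condExp_sq_le hT.comap_le memLp_fst_gauss_prod
    ((hg.comp (comap_measurable _)).stronglyMeasurable) hY2
  rw [estRisk, ← ofReal_integral_eq_lintegral_ofReal hsub.integrable_sq
    (Eventually.of_forall fun p => sq_nonneg _)]
  exact ENNReal.ofReal_le_ofReal this

/-- The conditional expectation is measurable for the σ-algebra generated by the observation, so by
Doob–Dynkin it factors through it. -/
theorem exists_estRisk_eq_condMMSE {f : ℝ → ℝ} (hf : Measurable f) (s : ℝ) :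
    ∃ g : ℝ × ℝ → ℝ, Measurable g ∧ estRisk f s g = ENNReal.ofReal (condMMSE gauss id f s) := by
  have hT : Measurable (fun p : ℝ × ℝ => (√s * p.1 + p.2, f p.1)) := by fun_prop
  obtain ⟨g, hg, hgE⟩ := (stronglyMeasurable_condExp
    (m := MeasurableSpace.comap (fun p : ℝ × ℝ => (√s * p.1 + p.2, f p.1)) inferInstance)
    (μ := gauss.prod gauss) (f := fun p : ℝ × ℝ => p.1)).measurable.exists_eq_measurable_comp
  refine ⟨g, hg, ?_⟩
  have hE := memLp_fst_gauss_prod.condExp (by norm_num)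
    (m := MeasurableSpace.comap (fun p : ℝ × ℝ => (√s * p.1 + p.2, f p.1)) inferInstance)
  have hi := (memLp_fst_gauss_prod.sub hE).integrable_sq
  refine Eq.trans ?_ (ofReal_integral_eq_lintegral_ofReal hi
    (Eventually.of_forall fun p => sq_nonneg _)).symm
  refine lintegral_congr fun p => ?_
  have := congrFun hgE p
  simp only [Function.comp] at this
  simp only [Pi.sub_apply, this]

theorem PiecewiseSmooth.measurable {f : ℝ → ℝ} (hf : PiecewiseSmooth f) : Measurable f := by
  obtain ⟨K, I, hI, -, hU, hC⟩ := hf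
  intro s hs
  have : f ⁻¹' s = ⋃ k, I k ∩ f ⁻¹' s := by rw [← iUnion_inter, hU, univ_inter]
  rw [this]
  refine MeasurableSet.iUnion fun k => ?_
  have hm : MeasurableSet (I k) := (hI k).measurableSet
  have hr : Measurable ((I k).domRestrict f) := ((hC k).1.continuousOn.domRestrict).measurable
  have := hm.subtype_image (hr hs)
  convert this using 1
  ext x; simp [and_comm]

/-! ### Monotonicity of `phi` -/

/-- Reflection invariance in the last two of three independent Gaussian variables. -/
theorem lintegral_gauss_triple_reflection {a b : ℝ} (h : a ^ 2 + b ^ 2 = 1)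
    {G : ℝ × ℝ × ℝ → ℝ≥0∞} (hG : Measurable G) :
    ∫⁻ w, ∫⁻ z, ∫⁻ n, G (z, a * n + b * w, b * n - a * w) ∂gauss ∂gauss ∂gauss =
      ∫⁻ z, ∫⁻ n, ∫⁻ m, G (z, n, m) ∂gauss ∂gauss ∂gauss := by
  have hG1 : Measurable (fun q : (ℝ × ℝ) × ℝ =>
      G (q.1.2, a * q.2 + b * q.1.1, b * q.2 - a * q.1.1)) :=
    hG.comp (by fun_prop)
  rw [lintegral_lintegral_swap hG1.lintegral_prod_right'.aemeasurable]
  refine lintegral_congr fun z => ?_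
  have hGz : Measurable (fun q : ℝ × ℝ => G (z, q)) :=
    hG.comp (measurable_const.prodMk measurable_id)
  have m1 : Measurable (fun q : ℝ × ℝ => G (z, a * q.1 + b * q.2, b * q.1 - a * q.2)) :=
    hG.comp (by fun_prop)
  have e1 := lintegral_prod_symm' (μ := gauss) (ν := gauss) _ m1
  have e2 := lintegral_prod (μ := gauss) (ν := gauss) _ hGz.aemeasurable
  exact e1.symm.trans ((lintegral_gauss_prod_reflection h hGz).trans e2)

/-- A second observation of the signal, in independent Gaussian noise, can be combined linearly
with an estimator that uses the first one only. -/
theorem condMMSE_add_le {f : ℝ → ℝ} (hf : Measurable f) {s Δ : ℝ} (hs : 0 ≤ s) (hΔ : 0 < Δ)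
    (c : ℝ) {g : ℝ × ℝ → ℝ} (hg : Measurable g) :
    ENNReal.ofReal (condMMSE gauss id f (s + Δ)) ≤
      ENNReal.ofReal ((1 - c) ^ 2) * estRisk f s g + ENNReal.ofReal (c ^ 2 / Δ) := by
  have hs2 : 0 < √(s + Δ) := Real.sqrt_pos.2 (by linarith)
  have hΔ' : 0 < √Δ := Real.sqrt_pos.2 hΔ
  have q1 : √s ^ 2 = s := Real.sq_sqrt hs
  have q2 : √(s + Δ) ^ 2 = s + Δ := Real.sq_sqrt (by linarith)
  have q3 : √Δ ^ 2 = Δ := Real.sq_sqrt hΔ.le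
  set r := √(s + Δ) with hr
  set d := √Δ with hd
  set t := √s with ht
  have hab : (t / r) ^ 2 + (d / r) ^ 2 = 1 := by
    field_simp; rw [q1, q2, q3]
  let G : ℝ → ℝ × ℝ → ℝ≥0∞ := fun z q =>
    ENNReal.ofReal (((1 - c) * (z - g (t * z + q.1, f z)) - c / d * q.2) ^ 2)
  have hG : Measurable (fun p : ℝ × ℝ × ℝ => G p.1 p.2) := by
    have : Measurable (fun p : ℝ × ℝ × ℝ => g (t * p.1 + p.2.1, f p.1)) :=
      hg.comp (by fun_prop)
    fun_prop
  -- From Y = r Z + N and an auxiliary independent Gaussian w one forms (t/r) Y + (d/r) w = t Z + n'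
  -- and (d/r) Y - (t/r) w = d Z + m', where (n', m') is a reflection of (N, w) and so has
  -- independent standard Gaussian coordinates. The estimator applies `g` to the first and divides
  -- the second by d; its error is (1 - c)(Z - g) - (c/d) m', the expression squared in `G`.
  let h : ℝ → ℝ × ℝ → ℝ := fun w y =>
    (1 - c) * g (t / r * y.1 + d / r * w, y.2) + c * (y.1 / r - t / r / d * w)
  have hh : ∀ w, Measurable (h w) := fun w => by
    have : Measurable (fun y : ℝ × ℝ => g (t / r * y.1 + d / r * w, y.2)) :=
      hg.comp (by fun_prop)
    fun_prop
  have hrisk : ∀ w, estRisk f (s + Δ) (h w) = ∫⁻ z, ∫⁻ n,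
      G z (t / r * n + d / r * w, d / r * n - t / r * w) ∂gauss ∂gauss := by
    intro w
    rw [estRisk, lintegral_prod]
    · refine lintegral_congr fun z => lintegral_congr fun n => ?_
      simp only [G, h, ← hr]
      have e1 : t / r * (r * z + n) + d / r * w = t * z + (t / r * n + d / r * w) := by
        field_simp; ring
      rw [e1]
      congr 2
      field_simp
      ring
    · have := (hh w).comp (g := h w) (f := fun p : ℝ × ℝ => (r * p.1 + p.2, f p.1)) (by fun_prop)
      exact (by fun_prop : Measurable fun p : ℝ × ℝ => ENNReal.ofReal
        ((p.1 - (h w ∘ fun p : ℝ × ℝ => (r * p.1 + p.2, f p.1)) p) ^ 2)).aemeasurable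
  -- For each fixed w, `h w` is an ordinary estimator, so the bound holds for each w and can be
  -- averaged over w.
  calc ENNReal.ofReal (condMMSE gauss id f (s + Δ))
      = ∫⁻ _ : ℝ, ENNReal.ofReal (condMMSE gauss id f (s + Δ)) ∂gauss := by simp
    _ ≤ ∫⁻ w, estRisk f (s + Δ) (h w) ∂gauss :=
        lintegral_mono fun w => condMMSE_le_estRisk hf _ (hh w)
    _ = ∫⁻ z, ∫⁻ n, ∫⁻ m, G z (n, m) ∂gauss ∂gauss ∂gauss := by
        rw [lintegral_congr hrisk]
        exact lintegral_gauss_triple_reflection hab hG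
    _ = ∫⁻ p : ℝ × ℝ, (ENNReal.ofReal ((1 - c) ^ 2) *
          ENNReal.ofReal ((p.1 - g (t * p.1 + p.2, f p.1)) ^ 2) + ENNReal.ofReal (c ^ 2 / Δ))
          ∂(gauss.prod gauss) := by
        have hgm : Measurable (fun p : ℝ × ℝ => g (t * p.1 + p.2, f p.1)) :=
          hg.comp (by fun_prop)
        rw [lintegral_prod _ (by fun_prop)]
        refine lintegral_congr fun z => lintegral_congr fun n => ?_
        simp only [G]
        rw [lintegral_gauss_sub_sq, ← ENNReal.ofReal_mul (sq_nonneg _),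
          ← ENNReal.ofReal_add (by positivity) (by positivity)]
        congr 1
        rw [div_pow, q3]; ring
    _ = _ := by
        have hgm : Measurable (fun p : ℝ × ℝ => g (t * p.1 + p.2, f p.1)) :=
          hg.comp (by fun_prop)
        rw [lintegral_add_right _ measurable_const, lintegral_const_mul _ (by fun_prop)]
        simp [estRisk, ht]

theorem condMMSE_add_le' {f : ℝ → ℝ} (hf : Measurable f) {s Δ : ℝ} (hs : 0 ≤ s) (hΔ : 0 < Δ)
    (c : ℝ) : ENNReal.ofReal (condMMSE gauss id f (s + Δ)) ≤
      ENNReal.ofReal ((1 - c) ^ 2) * ENNReal.ofReal (condMMSE gauss id f s) +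
        ENNReal.ofReal (c ^ 2 / Δ) := by
  obtain ⟨g, hg, he⟩ := exists_estRisk_eq_condMMSE hf s
  rw [← he]
  exact condMMSE_add_le hf hs hΔ c hg

/-- The minimum over c of (1 - c)² A + c²/Δ is the parallel sum (1/A + Δ)⁻¹. This optimisation
serves both `phi` and `Phi`. -/
theorem le_inv_add_of_forall {A B Δ : ℝ} (hA : 0 ≤ A) (hΔ : 0 < Δ)
    (h : ∀ c : ℝ, ENNReal.ofReal B ≤
      ENNReal.ofReal ((1 - c) ^ 2) * ENNReal.ofReal A + ENNReal.ofReal (c ^ 2 / Δ)) :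
    (ENNReal.ofReal A)⁻¹ + ENNReal.ofReal Δ ≤ (ENNReal.ofReal B)⁻¹ := by
  -- The minimiser of the quadratic in c.
  have h1 := h (Δ * A / (1 + Δ * A))
  have hp : 0 < 1 + Δ * A := by positivity
  rw [← ENNReal.ofReal_mul (sq_nonneg _),
    ← ENNReal.ofReal_add (by positivity) (by positivity)] at h1
  have e : (1 - Δ * A / (1 + Δ * A)) ^ 2 * A + (Δ * A / (1 + Δ * A)) ^ 2 / Δ
      = A / (1 + Δ * A) := by
    field_simp; ring
  rw [e] at h1
  refine le_trans ?_ (ENNReal.inv_le_inv.2 h1)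
  rcases hA.eq_or_lt with rfl | hA
  · simp
  · rw [← ENNReal.ofReal_inv_of_pos hA, ← ENNReal.ofReal_inv_of_pos (by positivity),
      ← ENNReal.ofReal_add (by positivity) hΔ.le]
    refine ENNReal.ofReal_le_ofReal (le_of_eq ?_)
    field_simp

theorem condMMSE_nonneg (f : ℝ → ℝ) (s : ℝ) : 0 ≤ condMMSE gauss id f s :=
  integral_nonneg fun _ => sq_nonneg _

/-- Passing from v to u raises the signal-to-noise ratio v⁻¹ - 1 by exactly u⁻¹ - v⁻¹. Subtracting
1/u from both sides turns this inequality into the monotonicity of φ. -/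
theorem inv_mmseZ_add_le {f : ℝ → ℝ} (hf : Measurable f) {u v : ℝ} (hu : 0 < u) (huv : u ≤ v)
    (hv : v ≤ 1) : (mmseZ f (ENNReal.ofReal v))⁻¹ + ENNReal.ofReal (u⁻¹ - v⁻¹) ≤
      (mmseZ f (ENNReal.ofReal u))⁻¹ := by
  have hv0 : 0 < v := hu.trans_le huv
  rcases huv.eq_or_lt with rfl | h
  · simp
  · have hi : v⁻¹ < u⁻¹ := inv_strictAnti₀ hu h
    have h1 : 1 ≤ v⁻¹ := (one_le_inv₀ hv0).2 hv
    have := le_inv_add_of_forall (A := condMMSE gauss id f (v⁻¹ - 1))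
      (B := condMMSE gauss id f (u⁻¹ - 1)) (Δ := u⁻¹ - v⁻¹) (condMMSE_nonneg _ _) (by linarith)
      (fun c => by
        have := condMMSE_add_le' hf (s := v⁻¹ - 1) (Δ := u⁻¹ - v⁻¹) (by linarith) (by linarith) c
        rwa [show v⁻¹ - 1 + (u⁻¹ - v⁻¹) = u⁻¹ - 1 by ring] at this)
    rwa [mmseZ, mmseZ, ENNReal.toReal_ofReal hv0.le, ENNReal.toReal_ofReal hu.le]

theorem phi_of_ne_zero (f : ℝ → ℝ) {v : ℝ≥0∞} (hv : v ≠ 0) :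
    phi f v = ((mmseZ f v)⁻¹ - v⁻¹)⁻¹ := if_neg hv

theorem phi_ofReal_mono {f : ℝ → ℝ} (hf : Measurable f) {u v : ℝ} (hu : 0 < u) (huv : u ≤ v)
    (hv : v ≤ 1) : phi f (ENNReal.ofReal u) ≤ phi f (ENNReal.ofReal v) := by
  have hv0 : 0 < v := hu.trans_le huv
  have hi : v⁻¹ ≤ u⁻¹ := inv_anti₀ hu huv
  rw [phi_of_ne_zero _ (by simpa using hu), phi_of_ne_zero _ (by simpa using hv0),
    ENNReal.inv_le_inv]
  calc (mmseZ f (ENNReal.ofReal v))⁻¹ - (ENNReal.ofReal v)⁻¹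
      = ((mmseZ f (ENNReal.ofReal v))⁻¹ + ENNReal.ofReal (u⁻¹ - v⁻¹)) -
          ((ENNReal.ofReal v)⁻¹ + ENNReal.ofReal (u⁻¹ - v⁻¹)) :=
        (ENNReal.add_sub_add_eq_sub_right ENNReal.ofReal_ne_top).symm
    _ ≤ (mmseZ f (ENNReal.ofReal u))⁻¹ - (ENNReal.ofReal u)⁻¹ := by
        refine tsub_le_tsub (inv_mmseZ_add_le hf hu huv hv) (le_of_eq ?_)
        rw [← ENNReal.ofReal_inv_of_pos hv0, ← ENNReal.ofReal_inv_of_pos hu,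
          ← ENNReal.ofReal_add (by positivity) (by linarith)]
        congr 1; ring

theorem phi_mono {f : ℝ → ℝ} (hf : Measurable f) {u v : ℝ≥0∞} (huv : u ≤ v) (hv : v ≤ 1) :
    phi f u ≤ phi f v := by
  have key : ∀ u v : ℝ≥0∞, u ≠ 0 → u ≤ v → v ≤ 1 → phi f u ≤ phi f v := by
    intro u v hu huv hv
    have hvt : v ≠ ⊤ := ne_top_of_le_ne_top ENNReal.one_ne_top hv
    have hut : u ≠ ⊤ := ne_top_of_le_ne_top hvt huv
    have := phi_ofReal_mono hf (ENNReal.toReal_pos hu hut) (ENNReal.toReal_mono hvt huv)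
      (by simpa using ENNReal.toReal_mono ENNReal.one_ne_top hv)
    rwa [ENNReal.ofReal_toReal hut, ENNReal.ofReal_toReal hvt] at this
  rcases eq_or_ne u 0 with rfl | hu
  · rcases eq_or_ne v 0 with rfl | hv0
    · exact le_rfl
    -- φ(0) is an upper limit at 0+, so it is controlled by the values at arguments w in (0, v).
    · conv_lhs => rw [phi, if_pos rfl]
      refine limsup_le_of_le (by isBoundedDefault) ?_
      have : Ioo (0 : ℝ≥0∞) v ∈ 𝓝[>] (0 : ℝ≥0∞) := Ioo_mem_nhdsGT (pos_iff_ne_zero.2 hv0)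
      filter_upwards [this] with w hw
      rw [← phi_of_ne_zero _ hw.1.ne']
      exact key w v hw.1.ne' hw.2.le hv
  · exact key u v hu huv hv

/-! ### The map `Phi` -/

/-- The upper-bound half of the variational formula: the two sides differ by a square over a
positive quantity. The right side is affine in T, so it can be integrated over the spectrum with one
common c. -/
theorem inv_inv_add_le {T : ℝ≥0∞} (hT : T ≠ ⊤) {Δ : ℝ} (hΔ : 0 < Δ) (c : ℝ) :
    (T⁻¹ + ENNReal.ofReal Δ)⁻¹ ≤
      ENNReal.ofReal ((1 - c) ^ 2) * T + ENNReal.ofReal (c ^ 2 / Δ) := by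
  lift T to NNReal using hT
  rcases eq_or_ne T 0 with rfl | hT
  · simp
  obtain ⟨t, rfl⟩ : ∃ t : ℝ, T = t.toNNReal := ⟨T, by simp⟩
  have ht : 0 < t := by simpa using hT
  change ((ENNReal.ofReal t)⁻¹ + _)⁻¹ ≤ _ * ENNReal.ofReal t + _
  rw [← ENNReal.ofReal_inv_of_pos ht, ← ENNReal.ofReal_add (by positivity) hΔ.le,
    ← ENNReal.ofReal_inv_of_pos (by positivity), ← ENNReal.ofReal_mul (sq_nonneg _),
    ← ENNReal.ofReal_add (by positivity) (by positivity)]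
  refine ENNReal.ofReal_le_ofReal ?_
  have hp : 0 < 1 + Δ * t := by positivity
  have e : (1 - c) ^ 2 * t + c ^ 2 / Δ - (t⁻¹ + Δ)⁻¹ =
      (c * (1 + Δ * t) - Δ * t) ^ 2 / (Δ * (1 + Δ * t)) := by
    have : t⁻¹ + Δ = (1 + Δ * t) / t := by field_simp
    rw [this]
    field_simp; ring
  have : 0 ≤ (c * (1 + Δ * t) - Δ * t) ^ 2 / (Δ * (1 + Δ * t)) := by positivity
  linarith

theorem inv_add_inv_le (w : ℝ≥0∞) (x : ℝ≥0∞) : (w + x⁻¹)⁻¹ ≤ x :=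
  ENNReal.inv_le_iff_inv_le.1 le_add_self

theorem IsEigenvalueLaw.ae_mem {P : Measure ℝ} (h : IsEigenvalueLaw P) :
    ∃ a b : ℝ, 0 < a ∧ a ≤ b ∧ ∀ᵐ x ∂P, x ∈ Icc a b := by
  obtain ⟨hp, a, b, ha, hab⟩ := h
  have hae : ∀ᵐ x ∂P, x ∈ Icc a b := ae_iff.2 hab
  obtain ⟨x, hx⟩ := hae.exists
  exact ⟨a, b, ha, hx.1.trans hx.2, hae⟩

theorem IsEigenvalueLaw.integrable_id {P : Measure ℝ} (h : IsEigenvalueLaw P) :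
    Integrable (fun x => x) P := by
  have := h.1
  obtain ⟨a, b, ha, -, hab⟩ := h.ae_mem
  refine Integrable.of_bound (by fun_prop) b ?_
  filter_upwards [hab] with x hx
  rw [Real.norm_of_nonneg (ha.le.trans hx.1)]
  exact hx.2

theorem IsEigenvalueLaw.integral_pos {P : Measure ℝ} (h : IsEigenvalueLaw P) :
    0 < ∫ x, x ∂P := by
  have := h.1
  obtain ⟨a, b, ha, -, hab⟩ := h.ae_mem
  calc 0 < a := ha
    _ = ∫ _, a ∂P := by simp
    _ ≤ ∫ x, x ∂P := integral_mono_ae (integrable_const _) h.integrable_id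
        (hab.mono fun x hx => hx.1)

theorem IsEigenvalueLaw.spectrumAt {ν : Measure ℝ} (h : IsEigenvalueLaw ν) {δ : ℝ} (hδ : 0 < δ) :
    IsEigenvalueLaw (spectrumAt ν δ) := by
  have := h.1
  obtain ⟨a, b, ha, -, hab⟩ := h.ae_mem
  have hc : 0 < δ / ∫ y, y ∂ν := div_pos hδ h.integral_pos
  have hm : Measurable (fun x : ℝ => δ / (∫ y, y ∂ν) * x) := by fun_prop
  refine ⟨Measure.isProbabilityMeasure_map hm.aemeasurable,
    δ / (∫ y, y ∂ν) * a, δ / (∫ y, y ∂ν) * b, by positivity, ?_⟩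
  rw [GLMEP.spectrumAt, Measure.map_apply hm measurableSet_Icc.compl]
  refine measure_mono_null ?_ (ae_iff.1 hab)
  intro x hx h'
  exact hx ⟨mul_le_mul_of_nonneg_left h'.1 hc.le, mul_le_mul_of_nonneg_left h'.2 hc.le⟩

theorem IsEigenvalueLaw.integral_spectrumAt {ν : Measure ℝ} (h : IsEigenvalueLaw ν) (δ : ℝ) :
    ∫ x, x ∂(GLMEP.spectrumAt ν δ) = δ := by
  rw [GLMEP.spectrumAt, integral_map (by fun_prop) (by fun_prop), integral_const_mul,
    div_mul_cancel₀ _ h.integral_pos.ne']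

theorem IsEigenvalueLaw.lintegral_ofReal {P : Measure ℝ} (h : IsEigenvalueLaw P) :
    ∫⁻ x, ENNReal.ofReal x ∂P = ENNReal.ofReal (∫ x, x ∂P) := by
  obtain ⟨a, b, ha, -, hab⟩ := h.ae_mem
  rw [ofReal_integral_eq_lintegral_ofReal h.integrable_id]
  exact hab.mono fun x hx => ha.le.trans hx.1

theorem Phi_of_ne_zero (P : Measure ℝ) (δ : ℝ) {v : ℝ≥0∞} (hv : v ≠ 0) : Phi P δ v =
    (((ENNReal.ofReal δ)⁻¹ * ∫⁻ x, (v⁻¹ + (ENNReal.ofReal x)⁻¹)⁻¹ ∂P)⁻¹ - v⁻¹)⁻¹ := if_neg hv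

theorem lintegral_inv_add_le {P : Measure ℝ} [IsProbabilityMeasure P] (w : ℝ≥0∞) {Δ : ℝ}
    (hΔ : 0 < Δ) (c : ℝ) : ∫⁻ x, (w + ENNReal.ofReal Δ + (ENNReal.ofReal x)⁻¹)⁻¹ ∂P ≤
      ENNReal.ofReal ((1 - c) ^ 2) * ∫⁻ x, (w + (ENNReal.ofReal x)⁻¹)⁻¹ ∂P +
        ENNReal.ofReal (c ^ 2 / Δ) := by
  calc _ ≤ ∫⁻ x, (ENNReal.ofReal ((1 - c) ^ 2) * (w + (ENNReal.ofReal x)⁻¹)⁻¹ +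
        ENNReal.ofReal (c ^ 2 / Δ)) ∂P := by
        refine lintegral_mono fun x => ?_
        have hT := ne_top_of_le_ne_top ENNReal.ofReal_ne_top
          (inv_add_inv_le w (ENNReal.ofReal x))
        refine le_trans (le_of_eq ?_) (inv_inv_add_le hT hΔ c)
        rw [inv_inv, add_right_comm]
    _ = _ := by
        rw [lintegral_add_right _ measurable_const, lintegral_const_mul _ (by fun_prop)]
        simp

theorem Phi_mono {P : Measure ℝ} (hP : IsEigenvalueLaw P) {δ : ℝ} (hδ : 1 ≤ δ) {u v : ℝ≥0∞}
    (huv : u ≤ v) : Phi P δ u ≤ Phi P δ v := by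
  have := hP.1
  rcases eq_or_ne u 0 with rfl | hu
  · simp [Phi]
  have hv : v ≠ 0 := (lt_of_lt_of_le (pos_iff_ne_zero.2 hu) huv).ne'
  have hui : u⁻¹ ≠ ⊤ := by simpa using hu
  have hvi : v⁻¹ ≠ ⊤ := by simpa using hv
  rcases huv.eq_or_lt with rfl | hlt
  · exact le_rfl
  have hi : v⁻¹ < u⁻¹ := ENNReal.inv_lt_inv.2 hlt
  obtain ⟨Δ, hΔ, hΔe⟩ : ∃ Δ : ℝ, 0 < Δ ∧ u⁻¹ = v⁻¹ + ENNReal.ofReal Δ := by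
    refine ⟨(u⁻¹ - v⁻¹).toReal, ENNReal.toReal_pos (tsub_pos_of_lt hi).ne' (by simp [hui]), ?_⟩
    rw [ENNReal.ofReal_toReal (by simp [hui]), add_tsub_cancel_of_le hi.le]
  have hδ0 : 0 < δ := by linarith
  have hδi : (ENNReal.ofReal δ)⁻¹ ≤ 1 := by
    rw [ENNReal.inv_le_one]; simpa using hδ
  set A := (ENNReal.ofReal δ)⁻¹ * ∫⁻ x, (v⁻¹ + (ENNReal.ofReal x)⁻¹)⁻¹ ∂P with hA
  set B := (ENNReal.ofReal δ)⁻¹ * ∫⁻ x, (u⁻¹ + (ENNReal.ofReal x)⁻¹)⁻¹ ∂P with hB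
  -- Here δ ≥ 1 matters: averaging puts a factor 1/δ on c²/Δ as well, and it can be dropped.
  have hBA : ∀ c : ℝ, B ≤ ENNReal.ofReal ((1 - c) ^ 2) * A + ENNReal.ofReal (c ^ 2 / Δ) := by
    intro c
    calc B ≤ (ENNReal.ofReal δ)⁻¹ * (ENNReal.ofReal ((1 - c) ^ 2) *
          ∫⁻ x, (v⁻¹ + (ENNReal.ofReal x)⁻¹)⁻¹ ∂P + ENNReal.ofReal (c ^ 2 / Δ)) := by
          rw [hB, hΔe]
          exact mul_le_mul_right (lintegral_inv_add_le _ hΔ c) _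
      _ ≤ _ := by
          rw [mul_add, hA, mul_left_comm]
          exact add_le_add_right (mul_le_of_le_one_left' hδi) _
  have hbound : ∀ w : ℝ≥0∞,
      (ENNReal.ofReal δ)⁻¹ * ∫⁻ x, (w + (ENNReal.ofReal x)⁻¹)⁻¹ ∂P ≠ ⊤ := by
    intro w
    refine ENNReal.mul_ne_top (by simpa using hδ0) (ne_top_of_le_ne_top ?_
      (lintegral_mono fun x => inv_add_inv_le w (ENNReal.ofReal x)))
    rw [hP.lintegral_ofReal]; exact ENNReal.ofReal_ne_top
  have hAt : A ≠ ⊤ := hbound _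
  have hBt : B ≠ ⊤ := hbound _
  have key := le_inv_add_of_forall (A := A.toReal) (B := B.toReal) ENNReal.toReal_nonneg hΔ
    (by rw [ENNReal.ofReal_toReal hAt, ENNReal.ofReal_toReal hBt]; exact hBA)
  rw [ENNReal.ofReal_toReal hAt, ENNReal.ofReal_toReal hBt] at key
  rw [Phi_of_ne_zero _ _ hu, Phi_of_ne_zero _ _ hv, ENNReal.inv_le_inv, ← hA, ← hB, hΔe,
    ← ENNReal.add_sub_add_eq_sub_right (a := A⁻¹) (b := v⁻¹) ENNReal.ofReal_ne_top]
  exact tsub_le_tsub_right key _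

/-- By monotonicity it suffices to look at v = ∞, where Φ equals 𝔼[λ] / δ = 1 by the normalization.
This keeps the iterates in the range where `phi_mono` applies. -/
theorem Phi_le_one {ν : Measure ℝ} (hν : IsEigenvalueLaw ν) {δ : ℝ} (hδ : 1 ≤ δ) (v : ℝ≥0∞) :
    Phi (spectrumAt ν δ) δ v ≤ 1 := by
  have hδ0 : 0 < δ := by linarith
  refine (Phi_mono (hν.spectrumAt hδ0) hδ (le_top (a := v))).trans ?_
  rw [Phi_of_ne_zero _ _ ENNReal.top_ne_zero]
  simp only [ENNReal.inv_top, zero_add, inv_inv, tsub_zero]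
  rw [(hν.spectrumAt hδ0).lintegral_ofReal, hν.integral_spectrumAt,
    ENNReal.inv_mul_cancel (by simpa using hδ0) ENNReal.ofReal_ne_top]

theorem seVr_le_one (f : ℝ → ℝ) {ν : Measure ℝ} (hν : IsEigenvalueLaw ν) {δ : ℝ} (hδ : 1 ≤ δ) :
    ∀ t, seVr f ν δ t ≤ 1
  | 0 => le_rfl
  | _ + 1 => Phi_le_one hν hδ _

theorem vrStar_le_one (f : ℝ → ℝ) {ν : Measure ℝ} (hν : IsEigenvalueLaw ν) {δ : ℝ}
    (hδ : 1 ≤ δ) : vrStar f ν δ ≤ 1 :=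
  limsup_le_of_le (by isBoundedDefault) (Eventually.of_forall (seVr_le_one f hν hδ))

/-- The spectrum is bounded away from 0 and ∞, so the integrand can vanish only when λ / v is
infinite. Perfect recovery thus becomes a statement about φ(V_r^⋆) alone. -/
theorem mse_eq_zero_iff {P : Measure ℝ} (hP : IsEigenvalueLaw P) (v : ℝ≥0∞) :
    mse P v = 0 ↔ v = 0 := by
  have := hP.1
  obtain ⟨a, b, ha, -, hab⟩ := hP.ae_mem
  rw [mse, lintegral_eq_zero_iff (by fun_prop)]
  constructor
  · intro h
    obtain ⟨x, hx, -⟩ := (h.and hab).exists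
    by_contra hv
    simp [ENNReal.div_eq_top, hv] at hx
  · rintro rfl
    filter_upwards [hab] with x hx
    have : ENNReal.ofReal x ≠ 0 := by simpa using ha.trans_le hx.1
    simp [ENNReal.div_zero this]

/-! ### The Lorenz order -/

/-- The uniform law on `(0, 1)`. -/
abbrev unif : Measure ℝ := volume.restrict (Ioo 0 1)

theorem quantile_set_bounds {ν : Measure ℝ} [IsProbabilityMeasure ν] {a b : ℝ}
    (hab : ∀ᵐ x ∂ν, x ∈ Icc a b) {y : ℝ} (hy : y ∈ Ioo (0 : ℝ) 1) :
    (∀ x < a, x ∈ {x : ℝ | cdf ν x ≤ y}) ∧ ∀ x ∈ {x : ℝ | cdf ν x ≤ y}, x ≤ b := by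
  refine ⟨fun x hx => ?_, fun x hx => ?_⟩
  · have : ν (Iic x) = 0 := by
      refine measure_mono_null (fun z hz => ?_) (ae_iff.1 hab)
      exact fun h => absurd (h.1.trans hz) (not_le.2 hx)
    simp [cdf_eq_real, measureReal_def, this, hy.1.le]
  · by_contra h
    have : ν (Iic x) = 1 := by
      rw [← prob_compl_eq_zero_iff measurableSet_Iic]
      exact measure_mono_null (t := (Icc a b)ᶜ)
        (compl_subset_compl.2 fun z hz => hz.2.trans (not_le.1 h).le) (ae_iff.1 hab)
    have h1 : cdf ν x ≤ y := hx
    rw [cdf_eq_real, measureReal_def, this] at h1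
    exact absurd hy.2 (not_lt.2 (by simpa using h1))

theorem quantile_mem {ν : Measure ℝ} [IsProbabilityMeasure ν] {a b : ℝ}
    (hab : ∀ᵐ x ∂ν, x ∈ Icc a b) {y : ℝ} (hy : y ∈ Ioo (0 : ℝ) 1) :
    quantile ν y ∈ Icc a b := by
  obtain ⟨h1, h2⟩ := quantile_set_bounds hab hy
  refine ⟨le_of_forall_lt fun x hx => ?_, csSup_le ⟨a - 1, h1 _ (by linarith)⟩ h2⟩
  obtain ⟨z, hz, hza⟩ := exists_between hx
  exact hz.trans_le (le_csSup ⟨b, h2⟩ (h1 z hza))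

theorem quantile_monotoneOn {ν : Measure ℝ} [IsProbabilityMeasure ν] {a b : ℝ}
    (hab : ∀ᵐ x ∂ν, x ∈ Icc a b) : MonotoneOn (quantile ν) (Ioo 0 1) := by
  intro y hy z hz hyz
  obtain ⟨h1, h2⟩ := quantile_set_bounds hab hy
  obtain ⟨h3, h4⟩ := quantile_set_bounds hab hz
  exact csSup_le_csSup ⟨b, h4⟩ ⟨a - 1, h1 _ (by linarith)⟩ fun x hx => le_trans hx hyz

theorem aemeasurable_quantile {ν : Measure ℝ} [IsProbabilityMeasure ν] {a b : ℝ}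
    (hab : ∀ᵐ x ∂ν, x ∈ Icc a b) : AEMeasurable (quantile ν) unif :=
  aemeasurable_restrict_of_monotoneOn measurableSet_Ioo (quantile_monotoneOn hab)

theorem quantile_le_of_lt_cdf {ν : Measure ℝ} [IsProbabilityMeasure ν] {a b : ℝ}
    (hab : ∀ᵐ x ∂ν, x ∈ Icc a b) {y : ℝ} (hy : y ∈ Ioo (0 : ℝ) 1) {x : ℝ} (h : y < cdf ν x) :
    quantile ν y ≤ x := by
  obtain ⟨h1, h2⟩ := quantile_set_bounds hab hy
  refine csSup_le ⟨a - 1, h1 _ (by linarith)⟩ fun z hz => ?_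
  by_contra hlt
  exact absurd (h.trans_le (monotone_cdf ν (not_le.1 hlt).le)) (not_lt.2 hz)

/-- Every z > x lies above the supremum, so y < F(z); right continuity lets z decrease to x. -/
theorem le_cdf_of_quantile_le {ν : Measure ℝ} [IsProbabilityMeasure ν] {a b : ℝ}
    (hab : ∀ᵐ x ∂ν, x ∈ Icc a b) {y : ℝ} (hy : y ∈ Ioo (0 : ℝ) 1) {x : ℝ}
    (h : quantile ν y ≤ x) : y ≤ cdf ν x := by
  obtain ⟨h1, h2⟩ := quantile_set_bounds hab hy
  have hr := ((cdf ν).right_continuous x).mono Ioi_subset_Ici_self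
  refine ge_of_tendsto (hr : Tendsto (cdf ν) (𝓝[>] x) (𝓝 (cdf ν x))) ?_
  filter_upwards [self_mem_nhdsWithin] with z hz
  by_contra hlt
  have : z ≤ quantile ν y := le_csSup ⟨b, h2⟩ (not_le.1 hlt).le
  exact absurd (this.trans h) (not_le.2 hz)

/-- Up to null sets the preimage of `Iic x` is (0, F(x)): the two quantile inequalities place it
between the open and the half-open interval. -/
theorem map_quantile {ν : Measure ℝ} [IsProbabilityMeasure ν] {a b : ℝ}
    (hab : ∀ᵐ x ∂ν, x ∈ Icc a b) : unif.map (quantile ν) = ν := by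
  have hm := aemeasurable_quantile hab
  have hfin : IsFiniteMeasure (unif.map (quantile ν)) := by infer_instance
  refine Measure.ext_of_Iic _ _ fun x => ?_
  rw [Measure.map_apply_of_aemeasurable hm measurableSet_Iic,
    Measure.restrict_apply' measurableSet_Ioo, ← ofReal_cdf]
  have hc1 := cdf_le_one ν x
  have hc0 := cdf_nonneg ν x
  refine le_antisymm ?_ ?_
  · calc volume (quantile ν ⁻¹' Iic x ∩ Ioo 0 1) ≤ volume (Ioc 0 (cdf ν x)) :=
          measure_mono fun y hy => mem_Ioc.2 ⟨hy.2.1, le_cdf_of_quantile_le hab hy.2 hy.1⟩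
      _ = _ := by simp
  · calc _ = volume (Ioo 0 (cdf ν x)) := by simp
      _ ≤ volume (quantile ν ⁻¹' Iic x ∩ Ioo 0 1) := measure_mono fun y hy =>
          ⟨quantile_le_of_lt_cdf hab ⟨hy.1, hy.2.trans_le hc1⟩ hy.2, hy.1, hy.2.trans_le hc1⟩

/-- If all partial integrals of `h` are nonpositive, so is the integral of `h` against a
nonincreasing weight. -/
theorem integral_mul_nonpos_of_antitoneOn {g h : ℝ → ℝ} (hg : AntitoneOn g (Ioo 0 1))
    (hg01 : ∀ y ∈ Ioo (0 : ℝ) 1, g y ∈ Icc (0 : ℝ) 1) (hh : Integrable h unif)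
    (hI : ∀ u ∈ Icc (0 : ℝ) 1, ∫ y in (0 : ℝ)..u, h y ≤ 0) : ∫ y, g y * h y ∂unif ≤ 0 := by
  have hgm : AEMeasurable g unif :=
    aemeasurable_restrict_of_antitoneOn measurableSet_Ioo hg
  -- Layer-cake formula: g(y) is the length of {t ∈ (0, 1) : t < g(y)}. After exchanging the
  -- integrals it remains to integrate h over superlevel sets of g.
  let S : Set (ℝ × ℝ) := {p | p.2 < g p.1}
  have hS : NullMeasurableSet S (unif.prod unif) :=
    nullMeasurableSet_lt measurable_snd.aemeasurable hgm.comp_fst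
  have hint : Integrable (S.indicator fun p : ℝ × ℝ => h p.1) (unif.prod unif) :=
    (hh.comp_fst _).indicator₀ hS
  have e1 : ∫ y, g y * h y ∂unif =
      ∫ y, ∫ t, S.indicator (fun p : ℝ × ℝ => h p.1) (y, t) ∂unif ∂unif := by
    refine setIntegral_congr_fun measurableSet_Ioo fun y hy => ?_
    have : (fun t => S.indicator (fun p : ℝ × ℝ => h p.1) (y, t)) =
        (Iio (g y)).indicator fun _ => h y := by
      funext t
      by_cases ht : t < g y <;> simp [S, indicator, ht]
    simp only [this]
    rw [integral_indicator measurableSet_Iio, Measure.restrict_restrict measurableSet_Iio,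
      setIntegral_const, smul_eq_mul, measureReal_def]
    have : Iio (g y) ∩ Ioo 0 1 = Ioo 0 (g y) := by
      ext t
      have := (hg01 y hy).2
      simp only [mem_inter_iff, mem_Iio, mem_Ioo]
      grind
    rw [this]
    simp [(hg01 y hy).1]
  rw [e1, integral_integral_swap (f := fun y t => S.indicator (fun p : ℝ × ℝ => h p.1) (y, t)) hint]
  refine integral_nonpos fun t => ?_
  -- Since g is nonincreasing, its superlevel set is an initial interval (0, u), up to the endpoint
  -- u.
  let T : Set ℝ := {y | y ∈ Ioo (0 : ℝ) 1 ∧ t < g y}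
  have hTb : BddAbove T := ⟨1, fun y hy => hy.1.2.le⟩
  by_cases hT : T.Nonempty
  · obtain ⟨y₀, hy₀⟩ := hT
    set u := sSup T with hu
    have hu0 : 0 < u := hy₀.1.1.trans_le (le_csSup hTb hy₀)
    have hu1 : u ≤ 1 := csSup_le ⟨y₀, hy₀⟩ fun y hy => hy.1.2.le
    have e2 : ∫ y, S.indicator (fun p : ℝ × ℝ => h p.1) (y, t) ∂unif = ∫ y in Ioo 0 u, h y := by
      have hsub : Ioo 0 u ⊆ Ioo (0 : ℝ) 1 := Ioo_subset_Ioo_right hu1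
      rw [← inter_eq_self_of_subset_left hsub, ← Measure.restrict_restrict measurableSet_Ioo,
        ← integral_indicator (f := h) measurableSet_Ioo]
      refine integral_congr_ae ?_
      have hne : ∀ᵐ y ∂unif, y ≠ u :=
        ae_restrict_of_ae (by simp [ae_iff, measure_singleton])
      filter_upwards [hne, ae_restrict_mem measurableSet_Ioo] with y hyu hy
      by_cases hty : t < g y
      · have : y ∈ Ioo 0 u :=
          ⟨hy.1, lt_of_le_of_ne (le_csSup hTb ⟨hy, hty⟩) hyu⟩
        rw [indicator_of_mem this, indicator_of_mem (show (y, t) ∈ S from hty)]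
      · have : y ∉ Ioo 0 u := by
          intro hy'
          obtain ⟨z, hz, hyz⟩ := exists_lt_of_lt_csSup ⟨y₀, hy₀⟩ hy'.2
          exact hty (hz.2.trans_le (hg hy hz.1 hyz.le))
        rw [indicator_of_notMem this, indicator_of_notMem (show (y, t) ∉ S from hty)]
    change ∫ y, S.indicator (fun p : ℝ × ℝ => h p.1) (y, t) ∂unif ≤ 0
    rw [e2, ← integral_Ioc_eq_integral_Ioo, ← intervalIntegral.integral_of_le hu0.le]
    exact hI u ⟨hu0.le, hu1⟩
  · refine le_of_eq ?_
    refine integral_eq_zero_of_ae ?_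
    filter_upwards [ae_restrict_mem measurableSet_Ioo] with y hy
    exact indicator_of_notMem (s := S) (fun h' => hT ⟨y, hy, h'⟩) _

theorem integral_comp_quantile {ν : Measure ℝ} [IsProbabilityMeasure ν] {a b : ℝ}
    (hab : ∀ᵐ x ∂ν, x ∈ Icc a b) {k : ℝ → ℝ} (hk : Measurable k) :
    ∫ x, k x ∂ν = ∫ y, k (quantile ν y) ∂unif := by
  conv_lhs => rw [← map_quantile hab]
  exact integral_map (aemeasurable_quantile hab) hk.aestronglyMeasurable

theorem integral_quantile_eq {ν : Measure ℝ} (hν : IsEigenvalueLaw ν) {u : ℝ} :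
    ∫ y in (0 : ℝ)..u, quantile ν y = (∫ x, x ∂ν) * lorenz ν u := by
  have := hν.1
  obtain ⟨a, b, ha, -, hab⟩ := hν.ae_mem
  have h1 : ∫ y in (0 : ℝ)..1, quantile ν y = ∫ x, x ∂ν := by
    rw [intervalIntegral.integral_of_le zero_le_one, integral_Ioc_eq_integral_Ioo]
    exact (integral_comp_quantile hab measurable_id).symm
  rw [lorenz, h1, mul_div_cancel₀ _ hν.integral_pos.ne']

theorem measurable_div_one_add (w : ℝ) : Measurable fun x : ℝ => x / (1 + w * x) := by
  fun_prop

/-- A spikier law with the same mean has smaller harmonic-type averages. -/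
theorem integral_le_of_spikier {ν₁ ν₂ : Measure ℝ} (h₁ : IsEigenvalueLaw ν₁)
    (h₂ : IsEigenvalueLaw ν₂) (hs : Spikier ν₁ ν₂) {δ w : ℝ} (hδ : 0 < δ) (hw : 0 ≤ w) :
    ∫ x, x / (1 + w * x) ∂(spectrumAt ν₁ δ) ≤ ∫ x, x / (1 + w * x) ∂(spectrumAt ν₂ δ) := by
  have := h₁.1
  have := h₂.1
  obtain ⟨a₁, b₁, ha₁, hab₁', hab₁⟩ := h₁.ae_mem
  obtain ⟨a₂, b₂, ha₂, hab₂', hab₂⟩ := h₂.ae_mem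
  have hm₁ := h₁.integral_pos
  have hm₂ := h₂.integral_pos
  set m₁ := ∫ x, x ∂ν₁ with hm₁'
  set m₂ := ∫ x, x ∂ν₂ with hm₂'
  let r₁ : ℝ → ℝ := fun y => δ / m₁ * quantile ν₁ y
  let r₂ : ℝ → ℝ := fun y => δ / m₂ * quantile ν₂ y
  have hc₁ : 0 < δ / m₁ := by positivity
  have hc₂ : 0 < δ / m₂ := by positivity
  have p₁ : ∀ y ∈ Ioo (0 : ℝ) 1, 0 < r₁ y := fun y hy =>
    mul_pos hc₁ (ha₁.trans_le (quantile_mem hab₁ hy).1)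
  have p₂ : ∀ y ∈ Ioo (0 : ℝ) 1, 0 < r₂ y := fun y hy =>
    mul_pos hc₂ (ha₂.trans_le (quantile_mem hab₂ hy).1)
  have hq₁ : Integrable (quantile ν₁) unif := by
    refine Integrable.of_bound (aemeasurable_quantile hab₁).aestronglyMeasurable b₁ ?_
    filter_upwards [ae_restrict_mem measurableSet_Ioo] with y hy
    have := quantile_mem hab₁ hy
    rw [Real.norm_of_nonneg (ha₁.le.trans this.1)]; exact this.2
  have hq₂ : Integrable (quantile ν₂) unif := by
    refine Integrable.of_bound (aemeasurable_quantile hab₂).aestronglyMeasurable b₂ ?_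
    filter_upwards [ae_restrict_mem measurableSet_Ioo] with y hy
    have := quantile_mem hab₂ hy
    rw [Real.norm_of_nonneg (ha₂.le.trans this.1)]; exact this.2
  have hr₁ : Integrable r₁ unif := hq₁.const_mul _
  have hr₂ : Integrable r₂ unif := hq₂.const_mul _
  have tr₁ : ∫ x, x / (1 + w * x) ∂(spectrumAt ν₁ δ) = ∫ y, r₁ y / (1 + w * r₁ y) ∂unif := by
    rw [spectrumAt, integral_map (by fun_prop) (measurable_div_one_add w).aestronglyMeasurable,
      integral_comp_quantile hab₁ (by fun_prop)]
  have tr₂ : ∫ x, x / (1 + w * x) ∂(spectrumAt ν₂ δ) = ∫ y, r₂ y / (1 + w * r₂ y) ∂unif := by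
    rw [spectrumAt, integral_map (by fun_prop) (measurable_div_one_add w).aestronglyMeasurable,
      integral_comp_quantile hab₂ (by fun_prop)]
  have hψ : ∀ r : ℝ → ℝ, Integrable r unif → (∀ y ∈ Ioo (0 : ℝ) 1, 0 < r y) →
      Integrable (fun y => r y / (1 + w * r y)) unif := by
    intro r hr hp
    have hrm := hr.aestronglyMeasurable.aemeasurable
    refine hr.mono (hrm.div (by fun_prop)).aestronglyMeasurable ?_
    filter_upwards [ae_restrict_mem measurableSet_Ioo] with y hy
    have := hp y hy
    rw [Real.norm_of_nonneg (by positivity), Real.norm_of_nonneg this.le]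
    exact div_le_self this.le (by nlinarith)
  -- The derivative of x ↦ x / (1 + w x) at r₂. It is nonincreasing in y because r₂ is
  -- nondecreasing, and by concavity the tangent at r₂ bounds the value at r₁.
  let g : ℝ → ℝ := fun y => 1 / (1 + w * r₂ y) ^ 2
  have hg01 : ∀ y ∈ Ioo (0 : ℝ) 1, g y ∈ Icc (0 : ℝ) 1 := by
    intro y hy
    have := p₂ y hy
    refine ⟨by positivity, ?_⟩
    rw [div_le_one (by positivity)]
    exact one_le_pow₀ (by nlinarith)
  have hga : AntitoneOn g (Ioo 0 1) := by
    intro y hy z hz hyz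
    have := p₂ y hy
    have h' : r₂ y ≤ r₂ z :=
      mul_le_mul_of_nonneg_left (quantile_monotoneOn hab₂ hy hz hyz) hc₂.le
    refine one_div_le_one_div_of_le (by positivity) ?_
    gcongr
  -- Both rescaled quantile functions have integral δ, so this partial integral is δ times the
  -- difference of the Lorenz curves.
  have hI : ∀ u ∈ Icc (0 : ℝ) 1, ∫ y in (0 : ℝ)..u, (r₁ y - r₂ y) ≤ 0 := by
    intro u hu
    have ii : ∀ q : ℝ → ℝ, Integrable q unif → IntervalIntegrable q volume 0 u := by
      intro q hq
      rw [intervalIntegrable_iff_integrableOn_Ioo_of_le hu.1]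
      exact IntegrableOn.mono_set hq (Ioo_subset_Ioo_right hu.2)
    rw [intervalIntegral.integral_sub (ii _ hr₁) (ii _ hr₂),
      intervalIntegral.integral_const_mul, intervalIntegral.integral_const_mul,
      integral_quantile_eq h₁, integral_quantile_eq h₂, ← mul_assoc, ← mul_assoc,
      div_mul_cancel₀ _ hm₁.ne', div_mul_cancel₀ _ hm₂.ne', ← mul_sub]
    exact mul_nonpos_of_nonneg_of_nonpos hδ.le (sub_nonpos.2 (hs u hu))
  have hgm : AEMeasurable g unif :=
    aemeasurable_restrict_of_antitoneOn measurableSet_Ioo hga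
  have hgh : Integrable (fun y => g y * (r₁ y - r₂ y)) unif := by
    refine (hr₁.sub hr₂).bdd_mul hgm.aestronglyMeasurable (c := 1) ?_
    filter_upwards [ae_restrict_mem measurableSet_Ioo] with y hy
    rw [Real.norm_of_nonneg (hg01 y hy).1]; exact (hg01 y hy).2
  have key := integral_mul_nonpos_of_antitoneOn hga hg01 (hr₁.sub hr₂) hI
  rw [tr₁, tr₂]
  have : ∫ y, r₁ y / (1 + w * r₁ y) ∂unif ≤
      ∫ y, (r₂ y / (1 + w * r₂ y) + g y * (r₁ y - r₂ y)) ∂unif := by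
    refine setIntegral_mono_on (hψ r₁ hr₁ p₁) ((hψ r₂ hr₂ p₂).add hgh) measurableSet_Ioo ?_
    intro y hy
    have q₁ := p₁ y hy
    have q₂ := p₂ y hy
    simp only [g]
    have e : r₂ y / (1 + w * r₂ y) + 1 / (1 + w * r₂ y) ^ 2 * (r₁ y - r₂ y) -
        r₁ y / (1 + w * r₁ y) =
        w * (r₁ y - r₂ y) ^ 2 / ((1 + w * r₂ y) ^ 2 * (1 + w * r₁ y)) := by
      have : 0 < 1 + w * r₂ y := by positivity
      have : 0 < 1 + w * r₁ y := by positivity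
      field_simp; ring
    have : 0 ≤ w * (r₁ y - r₂ y) ^ 2 / ((1 + w * r₂ y) ^ 2 * (1 + w * r₁ y)) := by positivity
    linarith
  rw [integral_add (hψ r₂ hr₂ p₂) hgh] at this
  simp only [Pi.sub_apply] at key
  linarith

/-! ### Comparison of thresholds for Lorenz-ordered spectra -/

theorem lintegral_inv_add_inv_eq {P : Measure ℝ} (hP : IsEigenvalueLaw P) {w : ℝ} (hw : 0 ≤ w) :
    ∫⁻ x, (ENNReal.ofReal w + (ENNReal.ofReal x)⁻¹)⁻¹ ∂P =
      ENNReal.ofReal (∫ x, x / (1 + w * x) ∂P) := by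
  obtain ⟨a, b, ha, -, hab⟩ := hP.ae_mem
  rw [ofReal_integral_eq_lintegral_ofReal]
  · refine lintegral_congr_ae ?_
    filter_upwards [hab] with x hx
    have hx0 : 0 < x := ha.trans_le hx.1
    rw [← ENNReal.ofReal_inv_of_pos hx0, ← ENNReal.ofReal_add hw (by positivity),
      ← ENNReal.ofReal_inv_of_pos (by positivity)]
    congr 1
    have : w + x⁻¹ = (1 + w * x) / x := by field_simp; ring
    rw [this, inv_div]
  · refine hP.integrable_id.mono (measurable_div_one_add w).aestronglyMeasurable ?_
    filter_upwards [hab] with x hx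
    have hx0 : 0 < x := ha.trans_le hx.1
    rw [Real.norm_of_nonneg (by positivity), Real.norm_of_nonneg hx0.le]
    exact div_le_self hx0.le (by nlinarith)
  · filter_upwards [hab] with x hx
    have hx0 : 0 < x := ha.trans_le hx.1
    positivity

theorem Phi_le_of_spikier {ν₁ ν₂ : Measure ℝ} (h₁ : IsEigenvalueLaw ν₁)
    (h₂ : IsEigenvalueLaw ν₂) (hs : Spikier ν₁ ν₂) {δ : ℝ} (hδ : 0 < δ) (v : ℝ≥0∞) :
    Phi (spectrumAt ν₁ δ) δ v ≤ Phi (spectrumAt ν₂ δ) δ v := by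
  rcases eq_or_ne v 0 with rfl | hv
  · simp [Phi]
  rw [Phi_of_ne_zero _ _ hv, Phi_of_ne_zero _ _ hv, ENNReal.inv_le_inv]
  refine tsub_le_tsub_right (ENNReal.inv_le_inv.2 (mul_le_mul_right ?_ _)) _
  have hvi : v⁻¹ ≠ ⊤ := by simpa using hv
  rw [← ENNReal.ofReal_toReal hvi, lintegral_inv_add_inv_eq (h₁.spectrumAt hδ) ENNReal.toReal_nonneg,
    lintegral_inv_add_inv_eq (h₂.spectrumAt hδ) ENNReal.toReal_nonneg]
  exact ENNReal.ofReal_le_ofReal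
    (integral_le_of_spikier h₁ h₂ hs hδ ENNReal.toReal_nonneg)

/-- Monotonicity of φ and Φ propagates the one-step comparison of the spectra to all iterates. The
set of successful sampling ratios can only grow, so its infimum can only drop. -/
theorem threshold_le_of_spikier {f : ℝ → ℝ} (hf : Measurable f) {ν₁ ν₂ : Measure ℝ}
    (h₁ : IsEigenvalueLaw ν₁) (h₂ : IsEigenvalueLaw ν₂) (hs : Spikier ν₁ ν₂) :
    threshold f ν₁ ≤ threshold f ν₂ := by
  refine sInf_le_sInf (image_mono ?_)
  rintro δ ⟨hδ, h0⟩
  have hδ0 : 0 < δ := by linarith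
  refine ⟨hδ, ?_⟩
  have hseq : ∀ t, seVr f ν₁ δ t ≤ seVr f ν₂ δ t := by
    intro t
    induction t with
    | zero => exact le_rfl
    | succ t ih =>
      exact (Phi_mono (h₁.spectrumAt hδ0) hδ.le
        (phi_mono hf ih (seVr_le_one f h₂ hδ.le t))).trans (Phi_le_of_spikier h₁ h₂ hs hδ0 _)
  have hV : vrStar f ν₁ δ ≤ vrStar f ν₂ δ :=
    limsup_le_limsup (Eventually.of_forall hseq)
  rw [mseStar, mse_eq_zero_iff (h₂.spectrumAt hδ0)] at h0
  rw [mseStar, mse_eq_zero_iff (h₁.spectrumAt hδ0)]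
  have := phi_mono hf hV (vrStar_le_one f h₂ hδ.le)
  rw [h0] at this
  exact le_zero_iff.1 this

/-! ### High signal-to-noise asymptotics of the mean squared error -/

/-- Normalised risk, in the coordinates `A = √(1-v) Z + √v N`, `W = √v Z - √(1-v) N`. -/
def normRisk (f : ℝ → ℝ) (v : ℝ) (g : ℝ × ℝ → ℝ) : ℝ≥0∞ :=
  ∫⁻ p : ℝ × ℝ, ENNReal.ofReal ((p.2 - g (p.1, f (√(1 - v) * p.1 + √v * p.2))) ^ 2)
    ∂(gauss.prod gauss)

/-- The reflection turns the noisy observation into A / √v, so observing it amounts to observing A,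
while Z = √(1-v) A + √v W with W independent of A. -/
theorem estRisk_eq_lintegral {f : ℝ → ℝ} (hf : Measurable f) {v : ℝ} (hv : 0 < v) (hv1 : v ≤ 1)
    {g : ℝ × ℝ → ℝ} (hg : Measurable g) :
    estRisk f (v⁻¹ - 1) g = ∫⁻ p : ℝ × ℝ, ENNReal.ofReal ((√(1 - v) * p.1 + √v * p.2 -
      g (p.1 / √v, f (√(1 - v) * p.1 + √v * p.2))) ^ 2) ∂(gauss.prod gauss) := by
  have hβ : 0 < √v := Real.sqrt_pos.2 hv
  have q1 : √(1 - v) ^ 2 = 1 - v := Real.sq_sqrt (by linarith)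
  have q2 : √v ^ 2 = v := Real.sq_sqrt hv.le
  have hs : √(v⁻¹ - 1) = √(1 - v) / √v := by
    rw [← Real.sqrt_div (by linarith)]
    congr 1; field_simp
  have hm : Measurable fun p : ℝ × ℝ =>
      ENNReal.ofReal ((p.1 - g (√(v⁻¹ - 1) * p.1 + p.2, f p.1)) ^ 2) := by
    have : Measurable (fun p : ℝ × ℝ => g (√(v⁻¹ - 1) * p.1 + p.2, f p.1)) :=
      hg.comp (by fun_prop)
    fun_prop
  rw [estRisk, ← lintegral_gauss_prod_reflection (a := √(1 - v)) (b := √v) (by rw [q1, q2]; ring) hm]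
  refine lintegral_congr fun p => ?_
  have e : √(v⁻¹ - 1) * (√(1 - v) * p.1 + √v * p.2) + (√v * p.1 - √(1 - v) * p.2) = p.1 / √v := by
    rw [hs]; field_simp; linear_combination p.1 * q1 + p.1 * q2
  simp only [e]

theorem mmseZ_ofReal (f : ℝ → ℝ) {v : ℝ} (hv : 0 ≤ v) :
    mmseZ f (ENNReal.ofReal v) = ENNReal.ofReal (condMMSE gauss id f (v⁻¹ - 1)) := by
  rw [mmseZ, ENNReal.toReal_ofReal hv]

/-- An estimator g of W gives the estimator √(1-v) A + √v g of Z, with error √v (W - g).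
`exists_normRisk_eq` inverts this correspondence at an optimal estimator. -/
theorem mmseZ_le_normRisk {f : ℝ → ℝ} (hf : Measurable f) {v : ℝ} (hv : 0 < v) (hv1 : v ≤ 1)
    {g : ℝ × ℝ → ℝ} (hg : Measurable g) :
    mmseZ f (ENNReal.ofReal v) ≤ ENNReal.ofReal v * normRisk f v g := by
  have hβ : 0 < √v := Real.sqrt_pos.2 hv
  have q2 : √v ^ 2 = v := Real.sq_sqrt hv.le
  have hG : Measurable (fun y : ℝ × ℝ => √(1 - v) * √v * y.1 + √v * g (√v * y.1, y.2)) := by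
    have : Measurable (fun y : ℝ × ℝ => g (√v * y.1, y.2)) := hg.comp (by fun_prop)
    fun_prop
  rw [mmseZ_ofReal f hv.le]
  refine (condMMSE_le_estRisk hf _ hG).trans (le_of_eq ?_)
  rw [estRisk_eq_lintegral hf hv hv1 hG, normRisk, ← lintegral_const_mul]
  · refine lintegral_congr fun p => ?_
    rw [← ENNReal.ofReal_mul hv.le, mul_div_cancel₀ _ hβ.ne']
    congr 1
    have : √(1 - v) * √v * (p.1 / √v) = √(1 - v) * p.1 := by field_simp
    rw [this]
    linear_combination (p.2 - g (p.1, f (√(1 - v) * p.1 + √v * p.2))) ^ 2 * q2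
  · have : Measurable (fun p : ℝ × ℝ => g (p.1, f (√(1 - v) * p.1 + √v * p.2))) :=
      hg.comp (by fun_prop)
    fun_prop

theorem exists_normRisk_eq {f : ℝ → ℝ} (hf : Measurable f) {v : ℝ} (hv : 0 < v) (hv1 : v ≤ 1) :
    ∃ g : ℝ × ℝ → ℝ, Measurable g ∧
      mmseZ f (ENNReal.ofReal v) = ENNReal.ofReal v * normRisk f v g := by
  have hβ : 0 < √v := Real.sqrt_pos.2 hv
  have q2 : √v ^ 2 = v := Real.sq_sqrt hv.le
  obtain ⟨G, hG, hGe⟩ := exists_estRisk_eq_condMMSE hf (v⁻¹ - 1)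
  have hG' : Measurable (fun y : ℝ × ℝ => G (y.1 / √v, y.2)) := hG.comp (by fun_prop)
  have hg : Measurable (fun y : ℝ × ℝ => (G (y.1 / √v, y.2) - √(1 - v) * y.1) / √v) := by
    fun_prop
  refine ⟨_, hg, ?_⟩
  rw [mmseZ_ofReal f hv.le, ← hGe, estRisk_eq_lintegral hf hv hv1 hG, normRisk,
    ← lintegral_const_mul]
  · refine lintegral_congr fun p => ?_
    rw [← ENNReal.ofReal_mul hv.le]
    congr 1
    field_simp
    rw [q2]
    ring
  · have : Measurable (fun p : ℝ × ℝ => (G (p.1 / √v, f (√(1 - v) * p.1 + √v * p.2)) -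
        √(1 - v) * p.1) / √v) := hg.comp (f := fun p : ℝ × ℝ =>
          (p.1, f (√(1 - v) * p.1 + √v * p.2))) (by fun_prop)
    fun_prop

/-! ### Flat sections and local inverses -/

/-- The set of points at which `f` is locally constant. -/
def flatSet (f : ℝ → ℝ) : Set ℝ := {x | ∀ᶠ y in 𝓝 x, f y = f x}

theorem isOpen_flatSet (f : ℝ → ℝ) : IsOpen (flatSet f) := by
  refine isOpen_iff_mem_nhds.2 fun x hx => ?_
  have hx' : ∀ᶠ y in 𝓝 x, f y = f x := hx
  filter_upwards [hx'.eventually_nhds, hx'] with y hy hyx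
  filter_upwards [hy] with z hz
  rw [hz, hyx]

/-- Passing to interiors loses only frontiers of intervals, which are null; on open pieces,
injective and constant behaviour can be read off locally. -/
theorem PiecewiseSmooth.exists_open_pieces {f : ℝ → ℝ} (hf : PiecewiseSmooth f) :
    ∃ (K : ℕ) (U : Fin K → Set ℝ), (∀ k, IsOpen (U k)) ∧
      Pairwise (fun j k => Disjoint (U j) (U k)) ∧ (∀ᵐ x : ℝ, ∃ k, x ∈ U k) ∧
      ∀ k, DifferentiableOn ℝ f (U k) ∧ (InjOn f (U k) ∨ ∃ c, ∀ x ∈ U k, f x = c) := by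
  obtain ⟨K, I, hI, hd, hU, hC⟩ := hf
  refine ⟨K, fun k => interior (I k), fun k => isOpen_interior, fun j k hjk =>
    (hd hjk).mono interior_subset interior_subset, ?_, fun k => ⟨?_, ?_⟩⟩
  · have h0 : ∀ᵐ x : ℝ, ∀ k, x ∉ frontier (I k) := ae_all_iff.2 fun k => by
      rw [ae_iff]
      simpa using (hI k).convex.addHaar_frontier volume
    filter_upwards [h0] with x hx
    have : x ∈ ⋃ k, I k := hU ▸ mem_univ x
    obtain ⟨k, hk⟩ := mem_iUnion.1 this
    refine ⟨k, ?_⟩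
    by_contra h
    exact hx k ⟨subset_closure hk, h⟩
  · exact ((hC k).1.differentiableOn (by norm_num)).mono interior_subset
  · rcases (hC k).2 with h | h | ⟨c, h⟩
    · exact Or.inl (h.injOn.mono interior_subset)
    · exact Or.inl (h.injOn.mono interior_subset)
    · exact Or.inr ⟨c, fun x hx => h x (interior_subset hx)⟩

theorem mem_flatSet_of_const {f : ℝ → ℝ} {U : Set ℝ} (hU : IsOpen U) {c : ℝ}
    (hc : ∀ x ∈ U, f x = c) {x : ℝ} (hx : x ∈ U) : x ∈ flatSet f := by
  have : ∀ᶠ y in 𝓝 x, f y = f x := by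
    filter_upwards [hU.mem_nhds hx] with y hy
    rw [hc y hy, hc x hx]
  exact this

theorem notMem_flatSet_of_injOn {f : ℝ → ℝ} {U : Set ℝ} (hU : IsOpen U) (hi : InjOn f U) {x : ℝ}
    (hx : x ∈ U) : x ∉ flatSet f := by
  intro h
  have h' : ∀ᶠ y in 𝓝 x, f y = f x := h
  have h2 : ∀ᶠ y in 𝓝 x, y = x := by
    filter_upwards [h', hU.mem_nhds hx] with y hy hyU using hi hyU hx hy
  have h3 : ∀ᶠ y in 𝓝[≠] x, y = x := h2.filter_mono nhdsWithin_le_nhds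
  obtain ⟨y, hy, hyx⟩ := (h3.and self_mem_nhdsWithin).exists
  exact hyx hy

/-- A measurable function that inverts `f` near almost every point outside the flat sections. -/
theorem PiecewiseSmooth.exists_local_inverse {f : ℝ → ℝ} (hf : PiecewiseSmooth f) :
    ∃ H : ℝ × ℝ → ℝ, Measurable H ∧
      ∀ᵐ a : ℝ, a ∉ flatSet f → ∀ᶠ x in 𝓝 a, H (a, f x) = x := by
  classical
  have hfm := hf.measurable
  obtain ⟨K, U, hU, hd, hae, hk⟩ := hf.exists_open_pieces
  have hinv : ∀ k, ∃ h : ℝ → ℝ, Measurable h ∧ (InjOn f (U k) → ∀ x ∈ U k, h (f x) = x) := by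
    intro k
    by_cases hi : InjOn f (U k)
    -- A measurable injection of a standard Borel space into ℝ is a measurable embedding, so its
    -- inverse extends measurably to ℝ.
    · have := (hU k).measurableSet.standardBorel
      have hm : Measurable ((U k).domRestrict f) := hfm.comp measurable_subtype_coe
      obtain ⟨h, hh, he⟩ := (hm.measurableEmbedding hi.injective).exists_measurable_extend
        (g := fun x : U k => (x : ℝ)) measurable_subtype_coe (fun _ => inferInstance)
      exact ⟨h, hh, fun _ x hx => congrFun he ⟨x, hx⟩⟩
    · exact ⟨fun _ => 0, measurable_const, fun h => absurd h hi⟩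
  choose h hh hhf using hinv
  -- f may take the same value on several pieces; the first coordinate, a point close to x, selects
  -- the piece on which to invert.
  refine ⟨fun p => ∑ k, (U k).indicator (fun _ => h k p.2) p.1, ?_, ?_⟩
  · refine Finset.measurable_sum _ fun k _ => ?_
    have : (fun p : ℝ × ℝ => (U k).indicator (fun _ => h k p.2) p.1) =
        (Prod.fst ⁻¹' U k).indicator fun p => h k p.2 := by
      funext p
      by_cases hp : p.1 ∈ U k <;> simp [indicator, hp]
    rw [this]
    exact ((hh k).comp measurable_snd).indicator (measurable_fst (hU k).measurableSet)
  · filter_upwards [hae] with a ⟨k, hak⟩ haF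
    rcases (hk k).2 with hi | ⟨c, hc⟩
    · filter_upwards [(hU k).mem_nhds hak] with x hx
      rw [Finset.sum_eq_single k]
      · rw [indicator_of_mem hak, hhf k hi x hx]
      · intro j _ hjk
        exact indicator_of_notMem (disjoint_right.1 (hd hjk) hak) _
      · simp
    · exact absurd (mem_flatSet_of_const (hU k) hc hak) haF

/-! ### Lower bound for the normalised risk -/

/-- The law on `ℝ` with density `w²` relative to the standard Gaussian law. -/
def gaussSq : Measure ℝ := gauss.withDensity fun w => ENNReal.ofReal (w ^ 2)

theorem gaussSq_univ : gaussSq univ = 1 := by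
  rw [gaussSq, withDensity_apply _ MeasurableSet.univ, Measure.restrict_univ, lintegral_gauss_sq]

theorem gaussSq_apply {s : Set ℝ} (hs : MeasurableSet s) :
    gaussSq s = ∫⁻ w in s, ENNReal.ofReal (w ^ 2) ∂gauss := withDensity_apply _ hs

instance : IsProbabilityMeasure gaussSq := ⟨gaussSq_univ⟩

theorem tendsto_gaussSq_Ioo :
    Tendsto (fun n : ℕ => gaussSq (Ioo (-(n : ℝ)) n)) atTop (𝓝 1) := by
  have hU : (⋃ n : ℕ, Ioo (-(n : ℝ)) n) = univ := by
    refine eq_univ_of_forall fun x => ?_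
    obtain ⟨n, hn⟩ := exists_nat_gt |x|
    exact mem_iUnion.2 ⟨n, abs_lt.1 hn⟩
  rw [← gaussSq_univ, ← hU]
  refine tendsto_measure_iUnion_atTop fun m n hmn => ?_
  have : (m : ℝ) ≤ n := by exact_mod_cast hmn
  exact Ioo_subset_Ioo (by linarith) this

/-- On a symmetric interval no constant estimates w better than 0 does: averaging over w and -w
replaces (w - c)² by w² + c². -/
theorem gaussSq_Ioo_le (T c : ℝ) :
    gaussSq (Ioo (-T) T) ≤ ∫⁻ w in Ioo (-T) T, ENNReal.ofReal ((w - c) ^ 2) ∂gauss := by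
  have hS : MeasurableSet (Ioo (-T) T) := measurableSet_Ioo
  set k : ℝ → ℝ≥0∞ := (Ioo (-T) T).indicator fun w => ENNReal.ofReal ((w - c) ^ 2) with hk
  have hkm : Measurable k := Measurable.indicator (by fun_prop) hS
  have hneg : ∫⁻ w, k (-w) ∂gauss = ∫⁻ w, k w ∂gauss := by
    have h0 : gauss.map (fun w => -w) = gauss := by rw [gaussianReal_map_neg, neg_zero]
    conv_rhs => rw [← h0]
    rw [lintegral_map hkm measurable_neg]
  have h2 : 2 * gaussSq (Ioo (-T) T) ≤ 2 * ∫⁻ w, k w ∂gauss := by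
    have e : 2 * ∫⁻ w, k w ∂gauss = ∫⁻ w, k w ∂gauss + ∫⁻ w, k (-w) ∂gauss := by
      rw [hneg, two_mul]
    rw [e, gaussSq_apply hS, ← lintegral_indicator hS, 
      ← lintegral_const_mul _ (Measurable.indicator (by fun_prop) hS), ← lintegral_add_left hkm]
    refine lintegral_mono fun w => ?_
    by_cases hw : w ∈ Ioo (-T) T
    · have hw' : -w ∈ Ioo (-T) T := ⟨by linarith [hw.2], by linarith [hw.1]⟩
      simp only [hk, indicator_of_mem hw, indicator_of_mem hw']
      rw [← ENNReal.ofReal_add (sq_nonneg _) (sq_nonneg _), ← ENNReal.ofReal_ofNat,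
        ← ENNReal.ofReal_mul (by norm_num)]
      exact ENNReal.ofReal_le_ofReal (by nlinarith [sq_nonneg c])
    · simp [indicator_of_notMem hw]
  rw [← lintegral_indicator hS]
  exact (ENNReal.mul_le_mul_iff_right (by norm_num) (by norm_num)).1 h2

theorem measurable_normRisk_integrand {f : ℝ → ℝ} (hf : Measurable f) (v : ℝ) {g : ℝ × ℝ → ℝ}
    (hg : Measurable g) : Measurable fun p : ℝ × ℝ =>
      ENNReal.ofReal ((p.2 - g (p.1, f (√(1 - v) * p.1 + √v * p.2))) ^ 2) := by
  have : Measurable (fun p : ℝ × ℝ => g (p.1, f (√(1 - v) * p.1 + √v * p.2))) :=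
    hg.comp (by fun_prop)
  fun_prop

/-- The normalised error on the flat sections is asymptotically at least `1`. -/
theorem one_le_liminf_of_mem_flatSet {f : ℝ → ℝ} {a : ℝ} (ha : a ∈ flatSet f) {v : ℕ → ℝ}
    (hv : Tendsto v atTop (𝓝 0)) (g : ℕ → ℝ × ℝ → ℝ) :
    1 ≤ liminf (fun n => ∫⁻ w, ENNReal.ofReal
      ((w - g n (a, f (√(1 - v n) * a + √(v n) * w))) ^ 2) ∂gauss) atTop := by
  have ha' : ∀ᶠ y in 𝓝 a, f y = f a := ha
  obtain ⟨r, hr, hball⟩ := Metric.eventually_nhds_iff.1 ha'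
  have hα : Tendsto (fun n => |√(1 - v n) * a - a|) atTop (𝓝 0) := by
    have : Tendsto (fun n => |√(1 - v n) * a - a|) atTop (𝓝 |√(1 - 0) * a - a|) :=
      ((((tendsto_const_nhds.sub hv).sqrt).mul_const a).sub_const a).abs
    simpa using this
  have hβ : Tendsto (fun n => √(v n)) atTop (𝓝 0) := by
    simpa using hv.sqrt
  -- For |w| < m and n large the point stays in the ball where f equals f(a), so the estimator is a
  -- constant there; m → ∞ then recovers the full second moment 1.
  refine le_of_tendsto' tendsto_gaussSq_Ioo fun m => ?_
  refine le_liminf_of_le (by isBoundedDefault) ?_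
  have h2 : Tendsto (fun n => √(v n) * m) atTop (𝓝 0) := by simpa using hβ.mul_const (m : ℝ)
  filter_upwards [hα.eventually_lt_const (half_pos hr), h2.eventually_lt_const (half_pos hr)]
    with n h3 h4
  refine (gaussSq_Ioo_le m (g n (a, f a))).trans ?_
  refine le_trans (le_of_eq ?_) (setLIntegral_le_lintegral (Ioo (-(m : ℝ)) m) _)
  refine setLIntegral_congr_fun measurableSet_Ioo fun w hw => ?_
  have hfw : f (√(1 - v n) * a + √(v n) * w) = f a := by
    refine hball ?_
    rw [Real.dist_eq]
    have e : √(1 - v n) * a + √(v n) * w - a = (√(1 - v n) * a - a) + √(v n) * w := by ring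
    have h5 : |√(v n) * w| ≤ √(v n) * m := by
      rw [abs_mul, abs_of_nonneg (Real.sqrt_nonneg _)]
      exact mul_le_mul_of_nonneg_left (abs_lt.2 hw).le (Real.sqrt_nonneg _)
    rw [e]
    have := abs_add_le (√(1 - v n) * a - a) (√(v n) * w)
    linarith
  simp only [hfw]

/-- Otherwise optimal estimators along some v_n → 0 all have normalised risk at most ρ. Fatou's
lemma over A, with the pointwise bound 1 on the flat sections, contradicts ρ < `gauss (flatSet f)`.
-/
theorem exists_le_mmseZ {f : ℝ → ℝ} (hf : Measurable f) {ρ : ℝ≥0∞} (hρ : ρ < gauss (flatSet f))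
    {r : ℝ} (hr : 0 < r) :
    ∃ v : ℝ, 0 < v ∧ v < r ∧ v ≤ 1 ∧ ENNReal.ofReal v * ρ ≤ mmseZ f (ENNReal.ofReal v) := by
  by_contra! hcon
  let v : ℕ → ℝ := fun n => min r 1 / (n + 2)
  have hm : 0 < min r 1 := lt_min hr one_pos
  have hv0 : ∀ n, 0 < v n := fun n => by positivity
  have hvm : ∀ n, v n < min r 1 := fun n => by
    rw [div_lt_iff₀ (by positivity)]
    have : (0 : ℝ) ≤ n := n.cast_nonneg
    nlinarith
  have hvr : ∀ n, v n < r := fun n => (hvm n).trans_le (min_le_left _ _)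
  have hv1 : ∀ n, v n ≤ 1 := fun n => (hvm n).le.trans (min_le_right _ _)
  have hvt : Tendsto v atTop (𝓝 0) := by
    refine Tendsto.const_div_atTop ?_ _
    exact tendsto_atTop_add_const_right _ _ tendsto_natCast_atTop_atTop
  have hg : ∀ n, ∃ g : ℝ × ℝ → ℝ, Measurable g ∧ normRisk f (v n) g ≤ ρ := by
    intro n
    obtain ⟨g, hg, he⟩ := exists_normRisk_eq hf (hv0 n) (hv1 n)
    refine ⟨g, hg, ?_⟩
    have := hcon (v n) (hv0 n) (hvr n) (hv1 n)
    rw [he] at this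
    exact (lt_of_mul_lt_mul_left' this).le
  choose g hg hgρ using hg
  refine absurd hρ (not_lt.2 ?_)
  calc gauss (flatSet f)
      = ∫⁻ a, (flatSet f).indicator 1 a ∂gauss :=
        (lintegral_indicator_one (isOpen_flatSet f).measurableSet).symm
    _ ≤ ∫⁻ a, liminf (fun n => ∫⁻ w, ENNReal.ofReal
          ((w - g n (a, f (√(1 - v n) * a + √(v n) * w))) ^ 2) ∂gauss) atTop ∂gauss := by
        refine lintegral_mono fun a => ?_
        by_cases ha : a ∈ flatSet f
        · simpa [ha] using one_le_liminf_of_mem_flatSet ha hvt g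
        · simp [ha]
    _ ≤ liminf (fun n => ∫⁻ a, ∫⁻ w, ENNReal.ofReal
          ((w - g n (a, f (√(1 - v n) * a + √(v n) * w))) ^ 2) ∂gauss ∂gauss) atTop :=
        lintegral_liminf_le fun n =>
          (measurable_normRisk_integrand hf (v n) (hg n)).lintegral_prod_right'
    _ ≤ ρ := by
        refine liminf_le_of_le (by isBoundedDefault) fun b hb => ?_
        obtain ⟨n, hn⟩ := hb.exists
        refine hn.trans (le_trans (le_of_eq ?_) (hgρ n))
        rw [normRisk, lintegral_prod _
          (measurable_normRisk_integrand hf (v n) (hg n)).aemeasurable]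

/-! ### Upper bound for the normalised risk -/

/-- Limit of the normalised squared error of the clipped inversion estimator. -/
def limitError (f : ℝ → ℝ) (T : ℝ) (p : ℝ × ℝ) : ℝ≥0∞ :=
  (flatSet f ×ˢ univ ∪ univ ×ˢ (Ioo (-T) T)ᶜ).indicator
    (fun p : ℝ × ℝ => ENNReal.ofReal (p.2 ^ 2)) p

theorem lintegral_limitError_le (f : ℝ → ℝ) (T : ℝ) :
    ∫⁻ p, limitError f T p ∂(gauss.prod gauss) ≤
      gauss (flatSet f) + gaussSq (Ioo (-T) T)ᶜ := by
  have hF := (isOpen_flatSet f).measurableSet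
  have hT : MeasurableSet (Ioo (-T) T)ᶜ := measurableSet_Ioo.compl
  have hsq : Measurable fun w : ℝ => ENNReal.ofReal (w ^ 2) := by fun_prop
  calc ∫⁻ p, limitError f T p ∂(gauss.prod gauss)
      ≤ ∫⁻ p : ℝ × ℝ, ((flatSet f).indicator 1 p.1 * ENNReal.ofReal (p.2 ^ 2) +
          1 * (Ioo (-T) T)ᶜ.indicator (fun w => ENNReal.ofReal (w ^ 2)) p.2)
          ∂(gauss.prod gauss) := by
        refine lintegral_mono fun p => ?_
        by_cases h1 : p.1 ∈ flatSet f
        · simp only [limitError, indicator, h1, if_true]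
          split_ifs <;> simp
        · by_cases h2 : p.2 ∈ Ioo (-T) T
          · simp only [mem_Ioo] at h2
            simp [limitError, indicator, h1, h2]
          · simp only [mem_Ioo] at h2
            simp [limitError, indicator, h1, h2]
    _ = (∫⁻ a, (flatSet f).indicator 1 a ∂gauss) * (∫⁻ w, ENNReal.ofReal (w ^ 2) ∂gauss) +
        (∫⁻ _, 1 ∂gauss) *
          ∫⁻ w, (Ioo (-T) T)ᶜ.indicator (fun w => ENNReal.ofReal (w ^ 2)) w ∂gauss := by
        have hm1 : Measurable ((flatSet f).indicator (1 : ℝ → ℝ≥0∞)) :=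
          measurable_one.indicator hF
        have hm2 : Measurable ((Ioo (-T) T)ᶜ.indicator fun w : ℝ => ENNReal.ofReal (w ^ 2)) :=
          hsq.indicator hT
        rw [lintegral_add_left (by fun_prop), lintegral_prod_mul (f := (flatSet f).indicator 1)
          (g := fun w => ENNReal.ofReal (w ^ 2)) hm1.aemeasurable hsq.aemeasurable,
          lintegral_prod_mul (f := fun _ => 1) (g := (Ioo (-T) T)ᶜ.indicator
            fun w : ℝ => ENNReal.ofReal (w ^ 2)) aemeasurable_const hm2.aemeasurable]
    _ = _ := by
        rw [lintegral_indicator_one hF, lintegral_gauss_sq, lintegral_indicator hT,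
          ← gaussSq_apply hT]
        simp

theorem exists_normRisk_tendsto {f : ℝ → ℝ} (hf : PiecewiseSmooth f) {T : ℝ} (hT : 0 < T) :
    ∃ g : ℝ → ℝ × ℝ → ℝ, (∀ v, Measurable (g v)) ∧
      Tendsto (fun v => normRisk f v (g v)) (𝓝[>] 0)
        (𝓝 (∫⁻ p, limitError f T p ∂(gauss.prod gauss))) := by
  classical
  have hfm := hf.measurable
  obtain ⟨H, hH, hHae⟩ := hf.exists_local_inverse
  let h : ℝ → ℝ × ℝ → ℝ := fun v y => (H y - √(1 - v) * y.1) / √v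
  have hh : ∀ v, Measurable (h v) := fun v => by fun_prop
  -- `h v` solves Z = √(1-v) A + √v W for W after inverting f. It is replaced by 0 when A is in a
  -- flat section, where inversion fails, and when it leaves (-T, T), which provides the dominating
  -- function 2 w² + 2 T².
  let g : ℝ → ℝ × ℝ → ℝ := fun v =>
    ((flatSet f)ᶜ ×ˢ univ ∩ h v ⁻¹' Ioo (-T) T).indicator (h v)
  have hg : ∀ v, Measurable (g v) := fun v => (hh v).indicator
    (((isOpen_flatSet f).measurableSet.compl.prod MeasurableSet.univ).inter
      ((hh v) measurableSet_Ioo))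
  refine ⟨g, hg, ?_⟩
  have hgT : ∀ v y, |g v y| ≤ T := by
    intro v y
    by_cases hy : y ∈ (flatSet f)ᶜ ×ˢ univ ∩ h v ⁻¹' Ioo (-T) T
    · simp only [g, indicator_of_mem hy]
      exact (abs_lt.2 hy.2).le
    · simp only [g, indicator_of_notMem hy]
      simpa using hT.le
  have hH2 : ∀ᵐ p : ℝ × ℝ ∂(gauss.prod gauss),
      p.1 ∉ flatSet f → ∀ᶠ x in 𝓝 p.1, H (p.1, f x) = x := by
    have : ∀ᵐ a ∂gauss, a ∉ flatSet f → ∀ᶠ x in 𝓝 a, H (a, f x) = x :=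
      (gaussianReal_absolutelyContinuous 0 one_ne_zero).ae_le hHae
    exact Measure.quasiMeasurePreserving_fst.ae this
  refine tendsto_lintegral_filter_of_dominated_convergence
    (fun p => ENNReal.ofReal (2 * p.2 ^ 2 + 2 * T ^ 2)) ?_ ?_ ?_ ?_
  · exact Eventually.of_forall fun v => measurable_normRisk_integrand hfm v (hg v)
  · refine Eventually.of_forall fun v => Eventually.of_forall fun p => ?_
    refine ENNReal.ofReal_le_ofReal ?_
    set y := g v (p.1, f (√(1 - v) * p.1 + √v * p.2)) with hy
    have h1 : y ^ 2 ≤ T ^ 2 := by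
      rw [← sq_abs y]
      exact pow_le_pow_left₀ (abs_nonneg _) (hgT _ _) 2
    nlinarith [sq_nonneg (p.2 + y)]
  · have : ∀ p : ℝ × ℝ, ENNReal.ofReal (2 * p.2 ^ 2 + 2 * T ^ 2) =
        1 * (ENNReal.ofReal 2 * ENNReal.ofReal (p.2 ^ 2) + ENNReal.ofReal (2 * T ^ 2)) := by
      intro p
      rw [ENNReal.ofReal_add (by positivity) (by positivity), ENNReal.ofReal_mul (by norm_num),
        one_mul]
    rw [lintegral_congr this, lintegral_prod_mul (f := fun _ => 1) (g := fun w : ℝ =>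
      ENNReal.ofReal 2 * ENNReal.ofReal (w ^ 2) + ENNReal.ofReal (2 * T ^ 2)) aemeasurable_const
      (by fun_prop), lintegral_add_right _ measurable_const,
      lintegral_const_mul _ (by fun_prop), lintegral_gauss_sq]
    simp [ENNReal.mul_eq_top]
  · filter_upwards [hH2] with p hp
    have hpos : ∀ᶠ v : ℝ in 𝓝[>] 0, 0 < v := self_mem_nhdsWithin
    by_cases h1 : p.1 ∈ flatSet f
    · refine tendsto_const_nhds.congr fun v => ?_
      simp [limitError, g, indicator, h1]
    · have hx : Tendsto (fun v : ℝ => √(1 - v) * p.1 + √v * p.2) (𝓝[>] 0) (𝓝 p.1) := by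
        have : Continuous fun v : ℝ => √(1 - v) * p.1 + √v * p.2 := by fun_prop
        have h0 := (this.tendsto 0).mono_left (nhdsWithin_le_nhds (s := Ioi (0 : ℝ)))
        simpa using h0
      refine tendsto_const_nhds.congr' ?_
      filter_upwards [hx.eventually (hp h1), hpos] with v hv hv0
      have hβ : √v ≠ 0 := (Real.sqrt_pos.2 hv0).ne'
      have hhv : h v (p.1, f (√(1 - v) * p.1 + √v * p.2)) = p.2 := by
        simp only [h, hv]
        field_simp
        ring
      by_cases h2 : p.2 ∈ Ioo (-T) T
      · have hmem : (p.1, f (√(1 - v) * p.1 + √v * p.2)) ∈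
            (flatSet f)ᶜ ×ˢ univ ∩ h v ⁻¹' Ioo (-T) T :=
          ⟨⟨h1, mem_univ _⟩, by rw [mem_preimage, hhv]; exact h2⟩
        have hnot : p ∉ flatSet f ×ˢ univ ∪ univ ×ˢ (Ioo (-T) T)ᶜ := by
          rintro (h | h)
          · exact h1 h.1
          · exact h.2 h2
        simp only [g]
        rw [indicator_of_mem hmem, hhv, limitError, indicator_of_notMem hnot]
        simp
      · have hmem : (p.1, f (√(1 - v) * p.1 + √v * p.2)) ∉
            (flatSet f)ᶜ ×ˢ univ ∩ h v ⁻¹' Ioo (-T) T := by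
          intro h
          have := h.2
          rw [mem_preimage, hhv] at this
          exact h2 this
        have hin : p ∈ flatSet f ×ˢ univ ∪ univ ×ˢ (Ioo (-T) T)ᶜ := Or.inr ⟨mem_univ _, h2⟩
        simp only [g]
        rw [indicator_of_notMem hmem, limitError, indicator_of_mem hin]
        simp

/-- The clipping costs the tail `gaussSq (Ioo (-n) n)ᶜ`, which tends to 0, so a large clipping level
brings the limiting risk below ρ. -/
theorem exists_mmseZ_le {f : ℝ → ℝ} (hf : PiecewiseSmooth f) {ρ : ℝ≥0∞}
    (hρ : gauss (flatSet f) < ρ) : ∃ r : ℝ, 0 < r ∧ r ≤ 1 ∧ ∀ v : ℝ, 0 < v → v ≤ r →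
      mmseZ f (ENNReal.ofReal v) ≤ ENNReal.ofReal v * ρ := by
  have htail : Tendsto (fun n : ℕ => gauss (flatSet f) + gaussSq (Ioo (-(n : ℝ)) n)ᶜ) atTop
      (𝓝 (gauss (flatSet f))) := by
    have : Tendsto (fun n : ℕ => gaussSq (Ioo (-(n : ℝ)) n)ᶜ) atTop (𝓝 0) := by
      simp_rw [prob_compl_eq_one_sub (μ := gaussSq) measurableSet_Ioo]
      simpa using ENNReal.Tendsto.sub tendsto_const_nhds tendsto_gaussSq_Ioo
        (Or.inl ENNReal.one_ne_top)
    simpa using tendsto_const_nhds.add this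
  obtain ⟨n, hn, hn0⟩ := ((htail.eventually_lt_const hρ).and (eventually_gt_atTop 0)).exists
  obtain ⟨g, hg, hgt⟩ := exists_normRisk_tendsto hf (T := n) (by exact_mod_cast hn0)
  have hev := hgt.eventually_lt_const ((lintegral_limitError_le f n).trans_lt hn)
  obtain ⟨r, hr, hsub⟩ := mem_nhdsGT_iff_exists_Ioc_subset.1 hev
  refine ⟨min r 1, lt_min hr one_pos, min_le_right _ _, fun v hv hvr => ?_⟩
  have : normRisk f v (g v) < ρ := hsub ⟨hv, hvr.trans (min_le_left _ _)⟩
  exact (mmseZ_le_normRisk hf.measurable hv (hvr.trans (min_le_right _ _)) (hg v)).trans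
    (mul_le_mul_right this.le _)

/-! ### The perfect recovery threshold -/

/-- The dictionary between a normalised error ρ and the slope ρ / (1 - ρ) of φ. -/
theorem ofReal_inv_sub_inv {v ρ : ℝ} (hv : 0 < v) (hρ : 0 < ρ) (hρ1 : ρ < 1) :
    ((ENNReal.ofReal v * ENNReal.ofReal ρ)⁻¹ - (ENNReal.ofReal v)⁻¹)⁻¹ =
      ENNReal.ofReal (ρ / (1 - ρ) * v) := by
  have h1 : 0 < 1 - ρ := by linarith
  rw [← ENNReal.ofReal_mul hv.le, ← ENNReal.ofReal_inv_of_pos (by positivity),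
    ← ENNReal.ofReal_inv_of_pos hv, ← ENNReal.ofReal_sub _ (by positivity)]
  have e : (v * ρ)⁻¹ - v⁻¹ = (ρ / (1 - ρ) * v)⁻¹ := by
    field_simp
  rw [e, ENNReal.ofReal_inv_of_pos (by positivity), inv_inv]

theorem le_phi {f : ℝ → ℝ} {v ρ : ℝ} (hv : 0 < v) (hρ : 0 < ρ) (hρ1 : ρ < 1)
    (h : ENNReal.ofReal v * ENNReal.ofReal ρ ≤ mmseZ f (ENNReal.ofReal v)) :
    ENNReal.ofReal (ρ / (1 - ρ) * v) ≤ phi f (ENNReal.ofReal v) := by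
  rw [phi_of_ne_zero _ (by simpa using hv), ← ofReal_inv_sub_inv hv hρ hρ1, ENNReal.inv_le_inv]
  exact tsub_le_tsub_right (ENNReal.inv_le_inv.2 h) _

theorem phi_le {f : ℝ → ℝ} {v ρ : ℝ} (hv : 0 < v) (hρ : 0 < ρ) (hρ1 : ρ < 1)
    (h : mmseZ f (ENNReal.ofReal v) ≤ ENNReal.ofReal v * ENNReal.ofReal ρ) :
    phi f (ENNReal.ofReal v) ≤ ENNReal.ofReal (ρ / (1 - ρ) * v) := by
  rw [phi_of_ne_zero _ (by simpa using hv), ← ofReal_inv_sub_inv hv hρ hρ1, ENNReal.inv_le_inv]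
  exact tsub_le_tsub_right (ENNReal.inv_le_inv.2 h) _

/-- Replacing every eigenvalue by its lower bound a leaves δ (1/x + 1/a) - 1/x, which is (δ - 1)/x
up to a bounded term. Near 0 the spectrum therefore does not affect the slope of Φ. -/
theorem le_Phi {P : Measure ℝ} [IsProbabilityMeasure P] {a : ℝ} (ha : 0 < a)
    (hP : ∀ᵐ y ∂P, a ≤ y) {δ x : ℝ} (hδ : 1 < δ) (hx : 0 < x) :
    ENNReal.ofReal (((δ - 1) / x + δ / a)⁻¹) ≤ Phi P δ (ENNReal.ofReal x) := by
  have hδ0 : 0 < δ := by linarith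
  have hδ1 : 0 < δ - 1 := by linarith
  rw [Phi_of_ne_zero _ _ (by simpa using hx), ENNReal.ofReal_inv_of_pos (by positivity),
    ENNReal.inv_le_inv]
  have h1 : ENNReal.ofReal ((x⁻¹ + a⁻¹)⁻¹) ≤
      ∫⁻ y, ((ENNReal.ofReal x)⁻¹ + (ENNReal.ofReal y)⁻¹)⁻¹ ∂P := by
    calc _ = ∫⁻ _, ENNReal.ofReal ((x⁻¹ + a⁻¹)⁻¹) ∂P := by simp
      _ ≤ _ := by
        refine lintegral_mono_ae ?_
        filter_upwards [hP] with y hy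
        rw [ENNReal.ofReal_inv_of_pos (by positivity), ENNReal.ofReal_add (by positivity)
          (by positivity), ENNReal.ofReal_inv_of_pos hx, ENNReal.ofReal_inv_of_pos ha]
        gcongr
  calc _ ≤ ((ENNReal.ofReal δ)⁻¹ * ENNReal.ofReal ((x⁻¹ + a⁻¹)⁻¹))⁻¹ - (ENNReal.ofReal x)⁻¹ :=
        tsub_le_tsub_right (ENNReal.inv_le_inv.2 (mul_le_mul_right h1 _)) _
    _ = _ := by
        rw [← ENNReal.ofReal_inv_of_pos hδ0, ← ENNReal.ofReal_mul (by positivity),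
          ← ENNReal.ofReal_inv_of_pos (by positivity), ← ENNReal.ofReal_inv_of_pos hx,
          ← ENNReal.ofReal_sub _ (by positivity)]
        congr 1
        field_simp
        ring

theorem Phi_le {P : Measure ℝ} {δ x A : ℝ} (hδ : 0 < δ) (hx : 0 < x) (hA : 0 < A)
    (hAx : A < δ * x) (h : ∫⁻ y, ((ENNReal.ofReal x)⁻¹ + (ENNReal.ofReal y)⁻¹)⁻¹ ∂P ≤
      ENNReal.ofReal A) :
    Phi P δ (ENNReal.ofReal x) ≤ ENNReal.ofReal ((δ / A - 1 / x)⁻¹) := by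
  have hpos : 0 < δ / A - 1 / x := by
    rw [sub_pos, div_lt_div_iff₀ hx hA]; linarith
  rw [Phi_of_ne_zero _ _ (by simpa using hx), ENNReal.ofReal_inv_of_pos hpos, ENNReal.inv_le_inv]
  calc ENNReal.ofReal (δ / A - 1 / x)
      = ((ENNReal.ofReal δ)⁻¹ * ENNReal.ofReal A)⁻¹ - (ENNReal.ofReal x)⁻¹ := by
        rw [← ENNReal.ofReal_inv_of_pos hδ, ← ENNReal.ofReal_mul (by positivity),
          ← ENNReal.ofReal_inv_of_pos (by positivity), ← ENNReal.ofReal_inv_of_pos hx,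
          ← ENNReal.ofReal_sub _ (by positivity)]
        congr 1
        field_simp
    _ ≤ _ := tsub_le_tsub_right (ENNReal.inv_le_inv.2 (mul_le_mul_right h _)) _

theorem Phi_le_div {P : Measure ℝ} [IsProbabilityMeasure P] {δ x : ℝ} (hδ : 1 < δ) (hx : 0 < x) :
    Phi P δ (ENNReal.ofReal x) ≤ ENNReal.ofReal (x / (δ - 1)) := by
  have hδ1 : 0 < δ - 1 := by linarith
  refine (Phi_le (A := x) (by linarith) hx hx (by nlinarith) ?_).trans (le_of_eq ?_)
  · calc _ ≤ ∫⁻ _, ENNReal.ofReal x ∂P := by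
          refine lintegral_mono fun y => ?_
          rw [add_comm]
          exact inv_add_inv_le _ _
      _ = _ := by simp
  · congr 1
    field_simp

/-- The condition says that the slope κ of φ at 0 exceeds δ - 1. Then one step maps some small v > 0
to at least v, and monotonicity makes v a floor for the whole state evolution. -/
theorem mseStar_ne_zero {f : ℝ → ℝ} (hf : Measurable f) {ν : Measure ℝ} (hν : IsEigenvalueLaw ν)
    {δ : ℝ} (hδ : 1 < δ) (h : ENNReal.ofReal (1 - δ⁻¹) < gauss (flatSet f)) :
    mseStar f ν δ ≠ 0 := by
  have hδ0 : 0 < δ := by linarith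
  have hδ1 : 0 < δ - 1 := by linarith
  have hP := hν.spectrumAt hδ0
  have := hP.1
  obtain ⟨a, b, ha, -, hab⟩ := hP.ae_mem
  obtain ⟨ρ, hρ0, h1, h2⟩ := ENNReal.lt_iff_exists_real_btwn.1 h
  have hδi : δ⁻¹ < 1 := inv_lt_one_of_one_lt₀ hδ
  have h1' : 1 - δ⁻¹ < ρ := (ENNReal.ofReal_lt_ofReal_iff_of_nonneg (by linarith)).1 h1
  have hρpos : 0 < ρ := by linarith
  have hρ1 : ρ < 1 := by
    have := h2.trans_le (prob_le_one (μ := gauss) (s := flatSet f))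
    simpa using this
  have hρ' : 0 < 1 - ρ := by linarith
  set κ := ρ / (1 - ρ) with hκ
  have hκ0 : 0 < κ := by positivity
  have hκδ : δ - 1 < κ := by
    rw [hκ, lt_div_iff₀ hρ']
    have : δ * δ⁻¹ = 1 := mul_inv_cancel₀ hδ0.ne'
    nlinarith
  have hs : 0 < 1 - (δ - 1) / κ := by
    rw [sub_pos, div_lt_one hκ0]; exact hκδ
  -- By `le_Phi` at x = κ v, the step returns at least v once (δ - 1)/κ + v δ/a ≤ 1; the radius
  -- encodes this.
  obtain ⟨v, hv, hvr, hv1, hvm⟩ := exists_le_mmseZ hf h2 (r := (1 - (δ - 1) / κ) * a / δ)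
    (by positivity)
  have hphi := le_phi hv hρpos hρ1 hvm
  have hstep : ENNReal.ofReal v ≤ Phi (spectrumAt ν δ) δ (phi f (ENNReal.ofReal v)) := by
    refine le_trans ?_ ((le_Phi ha (hab.mono fun y hy => hy.1) hδ
      (show 0 < κ * v by positivity)).trans (Phi_mono hP hδ.le hphi))
    refine ENNReal.ofReal_le_ofReal ?_
    rw [le_inv_comm₀ hv (by positivity)]
    rw [lt_div_iff₀ hδ0] at hvr
    have e : (δ - 1) / (κ * v) + δ / a = ((δ - 1) / κ + v * δ / a) / v := by field_simp
    rw [e, inv_eq_one_div]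
    refine div_le_div_of_nonneg_right ?_ hv.le
    have : v * δ / a ≤ 1 - (δ - 1) / κ := by
      rw [div_le_iff₀ ha]; exact hvr.le
    linarith
  have hseq : ∀ t, ENNReal.ofReal v ≤ seVr f ν δ t := by
    intro t
    induction t with
    | zero => simpa [seVr] using hv1
    | succ t ih =>
      exact hstep.trans (Phi_mono hP hδ.le (phi_mono hf ih (seVr_le_one f hν hδ.le t)))
  have hV : ENNReal.ofReal v ≤ vrStar f ν δ :=
    le_limsup_of_frequently_le (Frequently.of_forall hseq) (by isBoundedDefault)
  intro h0
  rw [mseStar, mse_eq_zero_iff hP] at h0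
  have h3 := hphi.trans (phi_mono hf hV (vrStar_le_one f hν hδ.le))
  rw [h0, nonpos_iff_eq_zero, ENNReal.ofReal_eq_zero] at h3
  exact absurd (show 0 < κ * v by positivity) (not_lt.2 h3)

theorem le_threshold {f : ℝ → ℝ} (hf : Measurable f) {ν : Measure ℝ} (hν : IsEigenvalueLaw ν) :
    (gauss (flatSet f)ᶜ)⁻¹ ≤ threshold f ν := by
  refine le_sInf ?_
  rintro _ ⟨δ, ⟨hδ, h0⟩, rfl⟩
  by_contra! hlt
  have hδ0 : 0 < δ := by linarith
  refine mseStar_ne_zero hf hν hδ ?_ h0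
  have h1 : gauss (flatSet f)ᶜ < ENNReal.ofReal δ⁻¹ := by
    rw [ENNReal.ofReal_inv_of_pos hδ0]
    exact ENNReal.lt_inv_iff_lt_inv.1 hlt
  have h2 : gauss (flatSet f) + gauss (flatSet f)ᶜ = 1 := by
    rw [measure_add_measure_compl (isOpen_flatSet f).measurableSet, measure_univ]
  rw [ENNReal.ofReal_sub _ (by positivity), ENNReal.ofReal_one, ← h2]
  refine ENNReal.sub_lt_of_lt_add ?_ ?_
  · rw [h2, ENNReal.ofReal_le_one]
    exact inv_le_one_of_one_le₀ hδ.le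
  · exact ENNReal.add_lt_add_left (measure_ne_top _ _) h1

/-- If the first step of the state evolution reaches the region in which `phi` is at most linear
with a small slope, then the recovery is perfect. -/
theorem mseStar_eq_zero {f : ℝ → ℝ} (hf : Measurable f) {ν : Measure ℝ} (hν : IsEigenvalueLaw ν)
    {δ κ r : ℝ} (hδ : 1 < δ) (hκ : 0 < κ) (hκδ : κ < δ - 1) (hr : 0 < r) (hr1 : r ≤ 1)
    (hphi : ∀ v : ℝ, 0 < v → v ≤ r → phi f (ENNReal.ofReal v) ≤ ENNReal.ofReal (κ * v))
    (h1 : seVr f ν δ 1 ≤ ENNReal.ofReal r) : mseStar f ν δ = 0 := by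
  have hδ0 : 0 < δ := by linarith
  have hδ1 : 0 < δ - 1 := by linarith
  have hP := hν.spectrumAt hδ0
  have := hP.1
  -- The contraction ratio of φ followed by Φ below r. The induction starts at index 1, because the
  -- initial value 1 need not lie in that region.
  set q := κ / (δ - 1) with hq
  have hq0 : 0 < q := by positivity
  have hq1 : q < 1 := by rw [hq, div_lt_one hδ1]; exact hκδ
  have hle : ∀ n : ℕ, q ^ n * r ≤ r := fun n =>
    mul_le_of_le_one_left hr.le (pow_le_one₀ hq0.le hq1.le)
  have hseq : ∀ n : ℕ, seVr f ν δ (n + 1) ≤ ENNReal.ofReal (q ^ n * r) := by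
    intro n
    induction n with
    | zero => simpa using h1
    | succ n ih =>
      have hp : 0 < q ^ n * r := by positivity
      have h2 : phi f (seVr f ν δ (n + 1)) ≤ ENNReal.ofReal (κ * (q ^ n * r)) :=
        (phi_mono hf ih (ENNReal.ofReal_le_one.2 ((hle n).trans hr1))).trans
          (hphi _ hp (hle n))
      refine ((Phi_mono hP hδ.le h2).trans (Phi_le_div hδ (by positivity))).trans (le_of_eq ?_)
      congr 1
      have : κ = q * (δ - 1) := by rw [hq]; field_simp
      rw [pow_succ, div_eq_iff hδ1.ne']
      linear_combination q ^ n * r * this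
  have hlim : Tendsto (seVr f ν δ) atTop (𝓝 0) := by
    rw [← tendsto_add_atTop_iff_nat 1]
    refine tendsto_of_tendsto_of_tendsto_of_le_of_le tendsto_const_nhds ?_
      (fun _ => zero_le) hseq
    have : Tendsto (fun n : ℕ => q ^ n * r) atTop (𝓝 (0 * r)) :=
      (tendsto_pow_atTop_nhds_zero_of_lt_one hq0.le hq1).mul_const r
    rw [zero_mul] at this
    simpa using ENNReal.tendsto_ofReal this
  have hV : vrStar f ν δ = 0 := hlim.limsup_eq
  rw [mseStar, mse_eq_zero_iff hP, hV, ← nonpos_iff_eq_zero]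
  -- V_r^⋆ = 0 does not by itself give φ(0) = 0; this follows from φ(0) ≤ φ(v) ≤ κ v for all small
  -- v.
  have hlim2 : Tendsto (fun v : ℝ => ENNReal.ofReal (κ * v)) (𝓝[>] 0) (𝓝 0) := by
    have : Continuous fun v : ℝ => ENNReal.ofReal (κ * v) :=
      ENNReal.continuous_ofReal.comp (by fun_prop)
    simpa using (this.tendsto 0).mono_left (nhdsWithin_le_nhds (s := Ioi (0 : ℝ)))
  refine ge_of_tendsto hlim2 ?_
  filter_upwards [Ioc_mem_nhdsGT hr] with v hv
  exact (phi_mono hf zero_le (ENNReal.ofReal_le_one.2 (hv.2.trans hr1))).trans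
    (hphi v hv.1 hv.2)

/-! ### Two-atom spectra -/

/-- The law with an atom of mass `p` at `a` and an atom of mass `1 - p` at `b`. -/
def twoAtoms (p a b : ℝ) : Measure ℝ :=
  ENNReal.ofReal p • Measure.dirac a + ENNReal.ofReal (1 - p) • Measure.dirac b

theorem isEigenvalueLaw_twoAtoms {p a b : ℝ} (hp : 0 < p) (hp1 : p < 1) (ha : 0 < a)
    (hab : a < b) : IsEigenvalueLaw (twoAtoms p a b) := by
  refine ⟨⟨?_⟩, a, b, ha, ?_⟩
  · simp only [twoAtoms, Measure.coe_add, Measure.coe_smul, Pi.add_apply, Pi.smul_apply,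
      measure_univ, smul_eq_mul, mul_one]
    rw [← ENNReal.ofReal_add hp.le (by linarith)]
    simp
  · simp [twoAtoms, hab.le]

theorem integral_twoAtoms {p a b : ℝ} (hp : 0 < p) (hp1 : p < 1) :
    ∫ x, x ∂(twoAtoms p a b) = p * a + (1 - p) * b := by
  have hi : ∀ c : ℝ, Integrable (fun x : ℝ => x) (Measure.dirac c) := fun c =>
    integrable_dirac (by simp)
  rw [twoAtoms, integral_add_measure ((hi a).smul_measure ENNReal.ofReal_ne_top)
    ((hi b).smul_measure ENNReal.ofReal_ne_top), integral_smul_measure, integral_smul_measure,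
    integral_dirac, integral_dirac, ENNReal.toReal_ofReal hp.le,
    ENNReal.toReal_ofReal (by linarith)]
  rfl

theorem spectrumAt_eq_self {ν : Measure ℝ} {δ : ℝ} (hδ : δ ≠ 0) (h : ∫ x, x ∂ν = δ) :
    spectrumAt ν δ = ν := by
  rw [spectrumAt, h, div_self hδ]
  simp

/-- A spiky two-atom law makes the first step of the state evolution arbitrarily good. -/
theorem exists_twoAtoms_seVr_le {f : ℝ → ℝ} (h1 : mmseZ f 1 < 1) {δ r : ℝ} (hδ : 1 < δ)
    (hr : 0 < r) : ∃ p a b : ℝ, 0 < a ∧ a < b ∧ 0 < p ∧ p < 1 ∧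
      seVr f (twoAtoms p a b) δ 1 ≤ ENNReal.ofReal r := by
  -- The assumption mmse_z(1) < 1 makes φ(1) finite; without it the first step would give Φ(∞) = 1
  -- for every spectrum.
  have hφ : phi f 1 < ⊤ := by
    rw [phi_of_ne_zero _ one_ne_zero, ENNReal.inv_lt_top, inv_one]
    exact tsub_pos_of_lt (ENNReal.one_lt_inv.2 h1)
  obtain ⟨x, hx0, hx⟩ : ∃ x : ℝ, 0 < x ∧ phi f 1 ≤ ENNReal.ofReal x := by
    refine ⟨(phi f 1).toReal + 1, by positivity, ?_⟩
    rw [ENNReal.ofReal_add ENNReal.toReal_nonneg zero_le_one, ENNReal.ofReal_toReal hφ.ne]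
    exact le_self_add
  have hδ0 : 0 < δ := by linarith
  -- With mass 1 - η at η and mass η at b, the two atoms contribute at most η and η x to 𝔼[(1/x +
  -- 1/λ)⁻¹], in total A = η (1 + x). The bound Φ(x) ≤ r needs δ/A ≥ 1/x + 1/r, which η c ≤ 1
  -- ensures. The value of b makes the mean equal to δ, so no rescaling occurs at this sampling
  -- ratio.
  set c := (1 + x) * (1 / x + 1 / r) with hc
  have hc0 : 0 < c := by positivity
  set η := min (1 / 2) (1 / c) with hη
  have hη0 : 0 < η := lt_min (by norm_num) (by positivity)
  have hη2 : η ≤ 1 / 2 := min_le_left _ _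
  have hηc : η * c ≤ 1 := by
    rw [← le_div_iff₀ hc0]; exact min_le_right _ _
  set b := (δ - (1 - η) * η) / η with hb
  have hab : η < b := by
    rw [hb, lt_div_iff₀ hη0]; nlinarith
  have hp0 : 0 < 1 - η := by linarith
  have hp1 : 1 - η < 1 := by linarith
  refine ⟨1 - η, η, b, hη0, hab, hp0, hp1, ?_⟩
  have hlaw := isEigenvalueLaw_twoAtoms hp0 hp1 hη0 hab
  have hmean : ∫ y, y ∂(twoAtoms (1 - η) η b) = δ := by
    rw [integral_twoAtoms hp0 hp1, hb]
    field_simp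
    ring
  have hspec := spectrumAt_eq_self hδ0.ne' hmean
  have hlaw' := hlaw.spectrumAt hδ0
  have hle : seVr f (twoAtoms (1 - η) η b) δ 1 ≤
      Phi (spectrumAt (twoAtoms (1 - η) η b) δ) δ (ENNReal.ofReal x) :=
    Phi_mono hlaw' hδ.le hx
  have hA0 : 0 < η * (1 + x) := by positivity
  have hkey : η * (1 + x) * (1 / x + 1 / r) ≤ 1 := by rw [mul_assoc]; exact hηc
  have hAx : η * (1 + x) < x := by
    have : η * (1 + x) * (1 / x) < 1 := by
      have : 0 < η * (1 + x) * (1 / r) := by positivity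
      linarith
    rwa [mul_one_div, div_lt_one hx0] at this
  refine hle.trans ((Phi_le (A := η * (1 + x)) hδ0 hx0 hA0 (by nlinarith) ?_).trans ?_)
  · rw [hspec, twoAtoms, lintegral_add_measure, lintegral_smul_measure, lintegral_smul_measure,
      lintegral_dirac' _ (by fun_prop), lintegral_dirac' _ (by fun_prop)]
    have hs : (1 : ℝ) - (1 - η) = η := by ring
    rw [hs, mul_add, mul_one, ENNReal.ofReal_add hη0.le (by positivity), ENNReal.ofReal_mul hη0.le]
    refine add_le_add ?_ ?_
    · rw [smul_eq_mul]
      refine (mul_le_mul_right (inv_add_inv_le _ _) _).trans (mul_le_of_le_one_left' ?_)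
      exact ENNReal.ofReal_le_one.2 hp1.le
    · rw [smul_eq_mul, add_comm]
      exact mul_le_mul_right (inv_add_inv_le _ _) _
  · refine ENNReal.ofReal_le_ofReal ?_
    have h2 : 1 / x + 1 / r ≤ δ / (η * (1 + x)) := by
      rw [le_div_iff₀ hA0]; linarith
    have h3 : 1 / r ≤ δ / (η * (1 + x)) - 1 / x := by linarith
    rw [inv_le_comm₀ (lt_of_lt_of_le (by positivity) h3) hr, inv_eq_one_div]
    exact h3

/-- Any δ strictly above 1 / (1 - ρ) makes κ < δ - 1 for a slope κ valid up to some radius r. As r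
does not involve the spectrum, the two-atom law can be chosen afterwards. -/
theorem exists_twoAtoms_threshold_lt {f : ℝ → ℝ} (hf : PiecewiseSmooth f) (h1 : mmseZ f 1 < 1)
    (hd : (gauss (flatSet f)ᶜ)⁻¹ < ⊤) {ε : ℝ≥0∞} (hε : 0 < ε) :
    ∃ p a b : ℝ, 0 < a ∧ a < b ∧ 0 < p ∧ p < 1 ∧
      threshold f (twoAtoms p a b) < (gauss (flatSet f)ᶜ)⁻¹ + ε := by
  set d := gauss (flatSet f)ᶜ with hdef
  have hd1 : 1 ≤ d⁻¹ := ENNReal.one_le_inv.2 prob_le_one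
  obtain ⟨δ, hδ0, hδ1, hδ2⟩ := ENNReal.lt_iff_exists_real_btwn.1
    (ENNReal.lt_add_right hd.ne hε.ne')
  have hδ : 1 < δ := by
    have := hd1.trans_lt hδ1
    simpa using this
  have hδp : 0 < δ := by linarith
  have hF : gauss (flatSet f) < ENNReal.ofReal (1 - δ⁻¹) := by
    have h2 : gauss (flatSet f) + d = 1 := by
      rw [measure_add_measure_compl (isOpen_flatSet f).measurableSet, measure_univ]
    have h3 : ENNReal.ofReal δ⁻¹ < d := by
      rw [ENNReal.ofReal_inv_of_pos hδp]
      exact ENNReal.inv_lt_iff_inv_lt.1 hδ1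
    rw [ENNReal.ofReal_sub _ (by positivity), ENNReal.ofReal_one, ← h2]
    refine lt_tsub_iff_right.2 ?_
    exact ENNReal.add_lt_add_left (measure_ne_top _ _) h3
  obtain ⟨ρ, hρ0, hρ1, hρ2⟩ := ENNReal.lt_iff_exists_real_btwn.1 hF
  have hρpos : 0 < ρ := ENNReal.ofReal_pos.1 (pos_of_gt hρ1)
  have hρδ : ρ < 1 - δ⁻¹ := (ENNReal.ofReal_lt_ofReal_iff_of_nonneg hρ0).1 hρ2
  have hδi : 0 < δ⁻¹ := by positivity
  have hρlt : ρ < 1 := by linarith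
  have hρ' : 0 < 1 - ρ := by linarith
  obtain ⟨r, hr, hr1, hmm⟩ := exists_mmseZ_le hf hρ1
  have hκ : ρ / (1 - ρ) < δ - 1 := by
    rw [div_lt_iff₀ hρ']
    have : δ * δ⁻¹ = 1 := mul_inv_cancel₀ hδp.ne'
    nlinarith
  obtain ⟨p, a, b, ha, hab, hp, hp1, hV⟩ := exists_twoAtoms_seVr_le h1 hδ hr
  refine ⟨p, a, b, ha, hab, hp, hp1, lt_of_le_of_lt (sInf_le ⟨δ, ⟨hδ, ?_⟩, rfl⟩) hδ2⟩
  exact mseStar_eq_zero hf.measurable (isEigenvalueLaw_twoAtoms hp hp1 ha hab) hδ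
    (by positivity) hκ hr hr1 (fun v hv hvr => phi_le hv hρpos hρlt (hmm v hv hvr)) hV

/-! ### Information dimension -/

theorem negMulLog_add_le {a b : ℝ} (ha : 0 ≤ a) (hb : 0 ≤ b) :
    Real.negMulLog (a + b) ≤ Real.negMulLog a + Real.negMulLog b := by
  rcases ha.eq_or_lt with rfl | ha
  · simp
  rcases hb.eq_or_lt with rfl | hb
  · simp
  have h1 : Real.log a ≤ Real.log (a + b) := Real.log_le_log ha (by linarith)
  have h2 : Real.log b ≤ Real.log (a + b) := Real.log_le_log hb (by linarith)
  simp only [Real.negMulLog]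
  nlinarith

/-- Contribution of an atom of mass `x` to the entropy. -/
abbrev atomEntropy (x : ℝ) : ℝ≥0∞ := ENNReal.ofReal (Real.negMulLog x)

theorem atomEntropy_le_one {x : ℝ} (hx : 0 ≤ x) : atomEntropy x ≤ 1 :=
  ENNReal.ofReal_le_one.2 ((Real.negMulLog_le_one_sub_self hx).trans (by linarith))

theorem entropy_add_le (α β : Measure ℤ) [IsFiniteMeasure α] [IsFiniteMeasure β] :
    entropy (α + β) ≤ entropy α + entropy β := by
  simp only [entropy]
  rw [← ENNReal.tsum_add]
  refine ENNReal.tsum_le_tsum fun k => ?_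
  rw [measureReal_add_apply]
  exact (ENNReal.ofReal_le_ofReal
    (negMulLog_add_le measureReal_nonneg measureReal_nonneg)).trans ENNReal.ofReal_add_le

theorem entropy_le_card {β : Measure ℤ} (S : Finset ℤ) (h : ∀ k ∉ S, β {k} = 0) :
    entropy β ≤ S.card := by
  rw [entropy, tsum_eq_sum (s := S)]
  · calc _ ≤ ∑ _k ∈ S, (1 : ℝ≥0∞) :=
          Finset.sum_le_sum fun k _ => atomEntropy_le_one measureReal_nonneg
      _ = S.card := by simp
  · intro k hk
    simp [measureReal_def, h k hk]

/-- Only the atoms in S change, and each contributes at most 1 to the entropy. -/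
theorem entropy_le_entropy_add_card {α β : Measure ℤ} [IsFiniteMeasure α] [IsFiniteMeasure β]
    (S : Finset ℤ) (h : ∀ k ∉ S, β {k} = 0) :
    entropy α ≤ entropy (α + β) + S.card := by
  classical
  calc entropy α ≤ ∑' k, (ENNReal.ofReal (Real.negMulLog ((α + β).real {k})) +
        if k ∈ S then 1 else 0) := by
        refine ENNReal.tsum_le_tsum fun k => ?_
        by_cases hk : k ∈ S
        · rw [if_pos hk]
          exact (atomEntropy_le_one measureReal_nonneg).trans le_add_self
        · have : (α + β).real {k} = α.real {k} := by
            simp [measureReal_def, h k hk]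
          rw [this]
          exact le_self_add
    _ = _ := by
        rw [ENNReal.tsum_add, tsum_eq_sum (s := S) (f := fun k => if k ∈ S then (1 : ℝ≥0∞) else 0)
          (fun k hk => if_neg hk)]
        simp [entropy]

/-- Jensen's inequality for the concave function -x log x with uniform weights 1/M. -/
theorem sum_negMulLog_le {M : ℕ} (hM : 0 < M) (a : Fin M → ℝ) (ha : ∀ j, 0 ≤ a j) :
    ∑ j, Real.negMulLog (a j) ≤ (∑ j, a j) * Real.log M + Real.negMulLog (∑ j, a j) := by
  have hM' : (0 : ℝ) < M := by exact_mod_cast hM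
  have h := Real.concaveOn_negMulLog.le_map_sum (t := Finset.univ) (w := fun _ : Fin M => (M : ℝ)⁻¹)
    (p := a) (fun _ _ => by positivity) (by simp [hM'.ne']) (fun j _ => ha j)
  simp only [smul_eq_mul, ← Finset.mul_sum] at h
  rw [Real.negMulLog_mul] at h
  have e : Real.negMulLog (M : ℝ)⁻¹ = (M : ℝ)⁻¹ * Real.log M := by
    simp [Real.negMulLog, Real.log_inv]
  rw [e] at h
  have h2 := mul_le_mul_of_nonneg_left h hM'.le
  have e1 : (M : ℝ) * ((M : ℝ)⁻¹ * ∑ j, Real.negMulLog (a j)) = ∑ j, Real.negMulLog (a j) := by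
    field_simp
  have e2 : (M : ℝ) * ((∑ j, a j) * ((M : ℝ)⁻¹ * Real.log M) +
      (M : ℝ)⁻¹ * Real.negMulLog (∑ j, a j)) =
      (∑ j, a j) * Real.log M + Real.negMulLog (∑ j, a j) := by
    field_simp
  rwa [e1, e2] at h2

/-- Refining every cell of a partition into `M` cells adds at most `log M` to the entropy. -/
theorem entropy_le_of_map_div {ρ : Measure ℤ} [IsFiniteMeasure ρ] (h1 : ρ univ ≤ 1) {M : ℕ}
    (hM : 0 < M) : entropy ρ ≤
      ρ univ * ENNReal.ofReal (Real.log M) + entropy (ρ.map fun k => k / (M : ℤ)) := by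
  have : NeZero M := ⟨hM.ne'⟩
  set τ := ρ.map fun k => k / (M : ℤ) with hτ
  have hm : Measurable fun k : ℤ => k / (M : ℤ) := measurable_of_countable _
  have hτu : τ univ = ρ univ := by rw [hτ, Measure.map_apply hm MeasurableSet.univ, preimage_univ]
  have hlog : 0 ≤ Real.log M := Real.log_natCast_nonneg M
  -- Euclidean division identifies ℤ with ℤ × `Fin M`; the second factor runs through the M refined
  -- cells inside cell i.
  have hsum : ∀ i : ℤ, ∑ j : Fin M, ρ.real {(Int.divModEquiv M).symm (i, j)} = τ.real {i} := by
    intro i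
    have hinj : Function.Injective fun j : Fin M => (Int.divModEquiv M).symm (i, j) :=
      fun j j' h => (Prod.mk.inj ((Int.divModEquiv M).symm.injective h)).2
    rw [hτ, map_measureReal_apply hm (measurableSet_singleton i),
      ← Finset.sum_image (f := fun k => ρ.real {k}) (s := Finset.univ) hinj.injOn,
      sum_measureReal_singleton]
    congr 1
    ext k
    simp only [Finset.coe_image, Finset.coe_univ, image_univ, mem_range, mem_preimage,
      mem_singleton_iff]
    constructor
    · rintro ⟨j, rfl⟩
      exact congrArg Prod.fst ((Int.divModEquiv M).apply_symm_apply (i, j))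
    · intro hk
      refine ⟨((Int.divModEquiv M) k).2, ?_⟩
      rw [Equiv.symm_apply_eq, ← hk]
      rfl
  have hcell : ∀ i : ℤ, ∑ j : Fin M,
      ENNReal.ofReal (Real.negMulLog (ρ.real {(Int.divModEquiv M).symm (i, j)})) ≤
      τ {i} * ENNReal.ofReal (Real.log M) + ENNReal.ofReal (Real.negMulLog (τ.real {i})) := by
    intro i
    have hρ1 : ∀ s, ρ.real s ≤ 1 := fun s =>
      ENNReal.toReal_le_of_le_ofReal zero_le_one (by
        simpa using (measure_mono (subset_univ s)).trans h1)
    rw [← ENNReal.ofReal_sum_of_nonneg fun j _ =>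
      Real.negMulLog_nonneg measureReal_nonneg (hρ1 _), ← ofReal_measureReal,
      ← ENNReal.ofReal_mul measureReal_nonneg]
    refine le_trans (ENNReal.ofReal_le_ofReal ?_) ENNReal.ofReal_add_le
    have := sum_negMulLog_le hM (fun j => ρ.real {(Int.divModEquiv M).symm (i, j)})
      (fun _ => measureReal_nonneg)
    rwa [hsum i] at this
  calc entropy ρ = ∑' i : ℤ, ∑ j : Fin M,
        ENNReal.ofReal (Real.negMulLog (ρ.real {(Int.divModEquiv M).symm (i, j)})) := by
        rw [entropy, ← (Int.divModEquiv M).symm.tsum_eq, ENNReal.tsum_prod']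
        simp [tsum_fintype]
    _ ≤ ∑' i : ℤ, (τ {i} * ENNReal.ofReal (Real.log M) +
          ENNReal.ofReal (Real.negMulLog (τ.real {i}))) := ENNReal.tsum_le_tsum hcell
    _ = _ := by
        rw [ENNReal.tsum_add, ENNReal.tsum_mul_right, ← hτu]
        congr 2
        have := Measure.tsum_indicator_apply_singleton τ univ MeasurableSet.univ
        simpa using this

/-- Entropy lower bound for a law that dominates a measure with small atoms. -/
theorem le_entropy_add_one {ρ α : Measure ℤ} [IsProbabilityMeasure ρ] (hα : α ≤ ρ) {c : ℝ}
    (hc : 0 < c) (h : ∀ k, α.real {k} ≤ c⁻¹) :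
    α univ * ENNReal.ofReal (Real.log c) ≤ entropy ρ + 1 := by
  have : IsFiniteMeasure α := isFiniteMeasure_of_le ρ hα
  -- With a ≤ p the two masses: a log c ≤ -a log a, then -a log a ≤ -a log p + p - a from log t ≤ t
  -- - 1 at t = p/a, and -a log p ≤ -p log p. The terms p sum to the 1 in the conclusion.
  have hpt : ∀ k : ℤ, α {k} * ENNReal.ofReal (Real.log c) ≤
      ENNReal.ofReal (Real.negMulLog (ρ.real {k})) + ρ {k} := by
    intro k
    have hle : α.real {k} ≤ ρ.real {k} := ENNReal.toReal_mono (measure_ne_top _ _) (hα {k})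
    have hp1 : ρ.real {k} ≤ 1 := measureReal_le_one
    have ha0 : 0 ≤ α.real {k} := measureReal_nonneg
    have hac := h k
    rw [← ofReal_measureReal (μ := α), ← ofReal_measureReal (μ := ρ), ← ENNReal.ofReal_mul ha0,
      ← ENNReal.ofReal_add (Real.negMulLog_nonneg (ha0.trans hle) hp1) (ha0.trans hle)]
    refine ENNReal.ofReal_le_ofReal ?_
    rcases ha0.eq_or_lt with h0 | h0
    · rw [← h0, zero_mul]
      exact add_nonneg (Real.negMulLog_nonneg (ha0.trans hle) hp1) (ha0.trans hle)
    · set a := α.real {k}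
      set p := ρ.real {k}
      have hp0 : 0 < p := h0.trans_le hle
      have h1 : Real.log c ≤ -Real.log a := by
        rw [← Real.log_inv]
        refine Real.log_le_log hc ?_
        rwa [le_inv_comm₀ hc h0]
      have h2 : Real.log p ≤ 0 := Real.log_nonpos hp0.le hp1
      have h3 : Real.log (p / a) ≤ p / a - 1 := Real.log_le_sub_one_of_pos (by positivity)
      rw [Real.log_div hp0.ne' h0.ne'] at h3
      have h4 : a * (Real.log p - Real.log a) ≤ p - a := by
        have := mul_le_mul_of_nonneg_left h3 h0.le
        rwa [mul_sub a (p / a), mul_div_cancel₀ _ h0.ne', mul_one] at this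
      simp only [Real.negMulLog]
      nlinarith
  have e1 := Measure.tsum_indicator_apply_singleton α univ MeasurableSet.univ
  have e2 := Measure.tsum_indicator_apply_singleton ρ univ MeasurableSet.univ
  simp only [indicator_univ, measure_univ] at e1 e2
  rw [← e1, ← ENNReal.tsum_mul_right, ← e2, entropy, ← ENNReal.tsum_add]
  exact ENNReal.tsum_le_tsum hpt

/-! ### Entropy of quantized laws -/

theorem measurable_floor_mul (M : ℕ) : Measurable fun x : ℝ => ⌊(M : ℝ) * x⌋ :=
  Int.measurable_floor.comp (by fun_prop)

instance (μ : Measure ℝ) [IsFiniteMeasure μ] (M : ℕ) : IsFiniteMeasure (quantizedLaw μ M) := by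
  unfold quantizedLaw; infer_instance

theorem quantizedLaw_univ (μ : Measure ℝ) (M : ℕ) : quantizedLaw μ M univ = μ univ := by
  rw [quantizedLaw, Measure.map_apply (measurable_floor_mul M) MeasurableSet.univ, preimage_univ]

theorem quantizedLaw_add (μ ν : Measure ℝ) (M : ℕ) :
    quantizedLaw (μ + ν) M = quantizedLaw μ M + quantizedLaw ν M :=
  Measure.map_add _ _ (measurable_floor_mul M)

theorem quantizedLaw_map_div (μ : Measure ℝ) {M : ℕ} (hM : 0 < M) :
    (quantizedLaw μ M).map (fun k => k / (M : ℤ)) = quantizedLaw μ 1 := by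
  have hM' : (M : ℝ) ≠ 0 := by exact_mod_cast hM.ne'
  rw [quantizedLaw, Measure.map_map (measurable_of_countable _) (measurable_floor_mul M),
    quantizedLaw]
  congr 1
  funext x
  simp only [Function.comp, Nat.cast_one, one_mul]
  rw [← Int.floor_div_natCast, mul_div_cancel_left₀ _ hM']

theorem quantizedLaw_singleton_eq_zero {μ : Measure ℝ} {S : Finset ℝ} (hS : μ (S : Set ℝ)ᶜ = 0)
    (M : ℕ) {k : ℤ} (hk : k ∉ S.image fun x : ℝ => ⌊(M : ℝ) * x⌋) :
    quantizedLaw μ M {k} = 0 := by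
  rw [quantizedLaw, Measure.map_apply (measurable_floor_mul M) (measurableSet_singleton k)]
  refine measure_mono_null (t := (S : Set ℝ)ᶜ) (fun x hx hxS => hk ?_) hS
  exact Finset.mem_image.2 ⟨x, hxS, hx⟩

/-- Upper bound for the entropy of the quantization of a mixture of a finitely supported measure
and another one. -/
theorem entropy_quantizedLaw_le {μc μd : Measure ℝ} [IsFiniteMeasure μc] [IsFiniteMeasure μd]
    (hμc : μc univ ≤ 1) {S : Finset ℝ} (hS : μd (S : Set ℝ)ᶜ = 0) {M : ℕ} (hM : 0 < M) :
    entropy (quantizedLaw (μc + μd) M) ≤ μc univ * ENNReal.ofReal (Real.log M) +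
      (entropy (quantizedLaw (μc + μd) 1) + S.card + S.card) := by
  have hcard : ∀ M : ℕ, ((S.image fun x : ℝ => ⌊(M : ℝ) * x⌋).card : ℝ≥0∞) ≤ S.card :=
    fun M => by exact_mod_cast Finset.card_image_le
  have h1 : entropy (quantizedLaw μd M) ≤ S.card :=
    (entropy_le_card _ fun k hk => quantizedLaw_singleton_eq_zero hS M hk).trans (hcard M)
  have h2 : entropy (quantizedLaw μc M) ≤ μc univ * ENNReal.ofReal (Real.log M) +
      entropy (quantizedLaw μc 1) := by
    have := entropy_le_of_map_div (ρ := quantizedLaw μc M)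
      (by rw [quantizedLaw_univ]; exact hμc) hM
    rwa [quantizedLaw_map_div _ hM, quantizedLaw_univ] at this
  have h3 : entropy (quantizedLaw μc 1) ≤ entropy (quantizedLaw (μc + μd) 1) + S.card := by
    rw [quantizedLaw_add]
    exact (entropy_le_entropy_add_card _
      fun k hk => quantizedLaw_singleton_eq_zero hS 1 hk).trans (add_le_add_right (hcard 1) _)
  rw [quantizedLaw_add]
  calc _ ≤ entropy (quantizedLaw μc M) + entropy (quantizedLaw μd M) := entropy_add_le _ _
    _ ≤ (μc univ * ENNReal.ofReal (Real.log M) +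
          (entropy (quantizedLaw (μc + μd) 1) + S.card)) + S.card :=
        add_le_add (h2.trans (add_le_add_right h3 _)) h1
    _ = _ := by rw [quantizedLaw_add, add_assoc]

/-- An absolutely continuous finite measure has parts with bounded density and almost full mass. -/
theorem exists_le_smul_volume {μ : Measure ℝ} [IsFiniteMeasure μ] (hμ : μ ≪ volume) {b : ℝ≥0∞}
    (hb : b < μ univ) : ∃ (K : ℝ) (ν : Measure ℝ), 0 < K ∧ ν ≤ μ ∧ b < ν univ ∧
      ∀ s, MeasurableSet s → ν s ≤ ENNReal.ofReal K * volume s := by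
  set g := μ.rnDeriv volume with hg
  have hgm : Measurable g := Measure.measurable_rnDeriv _ _
  -- Truncation where the density is at most n; the density is finite almost everywhere, so these
  -- sets exhaust the mass.
  let A : ℕ → Set ℝ := fun n => {x | g x ≤ n}
  have hA : ∀ n, MeasurableSet (A n) := fun n => measurableSet_le hgm measurable_const
  have hmono : Monotone A := fun m n hmn x (hx : g x ≤ m) =>
    hx.trans (by exact_mod_cast hmn)
  have hlim : Tendsto (fun n => μ (A n)) atTop (𝓝 (μ univ)) := by
    have hU : μ (⋃ n, A n) = μ univ := by
      refine measure_congr (eventuallyEq_univ.2 ?_)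
      filter_upwards [hμ.ae_le (Measure.rnDeriv_lt_top μ volume)] with x hx
      obtain ⟨n, hn⟩ := ENNReal.exists_nat_gt hx.ne
      exact mem_iUnion.2 ⟨n, hn.le⟩
    rw [← hU]
    exact tendsto_measure_iUnion_atTop hmono
  obtain ⟨n, hn, hn0⟩ := ((hlim.eventually_const_lt hb).and (eventually_gt_atTop 0)).exists
  refine ⟨n, μ.restrict (A n), by exact_mod_cast hn0, Measure.restrict_le_self, ?_, ?_⟩
  · rwa [Measure.restrict_apply_univ]
  · intro s hs
    rw [Measure.restrict_apply hs, ← Measure.setLIntegral_rnDeriv hμ, ENNReal.ofReal_natCast]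
    calc ∫⁻ x in s ∩ A n, g x ≤ ∫⁻ _ in s ∩ A n, (n : ℝ≥0∞) :=
          setLIntegral_mono measurable_const fun x hx => hx.2
      _ = n * volume (s ∩ A n) := by rw [setLIntegral_const]
      _ ≤ _ := mul_le_mul_right (measure_mono inter_subset_left) _

theorem volume_floor_preimage {M : ℕ} (hM : 0 < M) (k : ℤ) :
    volume ((fun x : ℝ => ⌊(M : ℝ) * x⌋) ⁻¹' {k}) = ENNReal.ofReal (M : ℝ)⁻¹ := by
  have hM' : (0 : ℝ) < M := by exact_mod_cast hM
  have : (fun x : ℝ => ⌊(M : ℝ) * x⌋) ⁻¹' {k} = Ico ((k : ℝ) / M) ((k + 1) / M) := by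
    ext x
    simp only [mem_preimage, mem_singleton_iff, Int.floor_eq_iff, mem_Ico, div_le_iff₀ hM',
      lt_div_iff₀ hM', mul_comm x]
  rw [this, Real.volume_Ico]
  congr 1
  field_simp
  ring

theorem le_entropy_quantizedLaw {μ ν : Measure ℝ} [IsProbabilityMeasure μ] (hν : ν ≤ μ) {K : ℝ}
    (hK : 0 < K) (h : ∀ s, MeasurableSet s → ν s ≤ ENNReal.ofReal K * volume s) {M : ℕ}
    (hM : 0 < M) :
    ν univ * ENNReal.ofReal (Real.log (M / K)) ≤ entropy (quantizedLaw μ M) + 1 := by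
  have hM' : (0 : ℝ) < M := by exact_mod_cast hM
  have hp : IsProbabilityMeasure (quantizedLaw μ M) :=
    ⟨by rw [quantizedLaw_univ, measure_univ]⟩
  have := le_entropy_add_one (ρ := quantizedLaw μ M) (α := quantizedLaw ν M)
    (Measure.map_mono hν (measurable_floor_mul M)) (c := M / K) (by positivity) ?_
  · rwa [quantizedLaw_univ] at this
  · intro k
    refine ENNReal.toReal_le_of_le_ofReal (by positivity) ?_
    rw [quantizedLaw, Measure.map_apply (measurable_floor_mul M) (measurableSet_singleton k)]
    refine (h _ (measurable_floor_mul M (measurableSet_singleton k))).trans (le_of_eq ?_)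
    rw [volume_floor_preimage hM, ← ENNReal.ofReal_mul hK.le, inv_div, div_eq_mul_inv]

/-- **Rényi's theorem** on the information dimension of a mixture of an absolutely continuous
and a finitely supported law. -/
theorem hasInfoDim_add {μc μd : Measure ℝ} [IsFiniteMeasure μc] [IsFiniteMeasure μd]
    [IsProbabilityMeasure (μc + μd)] (hac : μc ≪ volume) {S : Finset ℝ}
    (hS : μd (S : Set ℝ)ᶜ = 0) (hH : entropy (quantizedLaw (μc + μd) 1) < ⊤) :
    HasInfoDim (μc + μd) (μc univ) := by
  have hμc : μc univ ≤ 1 := by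
    rw [← measure_univ (μ := μc + μd), Measure.add_apply]; exact le_self_add
  have hlog : Tendsto (fun M : ℕ => Real.log M) atTop atTop :=
    Real.tendsto_log_atTop.comp tendsto_natCast_atTop_atTop
  have hlog' : Tendsto (fun M : ℕ => ENNReal.ofReal (Real.log M)) atTop (𝓝 ⊤) :=
    ENNReal.tendsto_ofReal_nhds_top.2 hlog
  refine tendsto_order.2 ⟨fun b hb => ?_, fun b hb => ?_⟩
  -- Lower bound: a part ν of mass above b with density at most K gives cells of mass at most K/M,
  -- so the entropy is at least ν(ℝ)(log M - log K) - 1. Dividing by log M removes the constants.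
  · obtain ⟨K, ν, hK, hν, hbν, hνK⟩ := exists_le_smul_volume hac hb
    have hνμ : ν ≤ μc + μd := hν.trans (Measure.le_add_right le_rfl)
    have hνt : ν univ ≠ ⊤ := ne_top_of_le_ne_top (measure_ne_top μc univ) (hν univ)
    have hbt : b ≠ ⊤ := hb.ne_top
    set m := (ν univ).toReal with hm
    have hlim : Tendsto (fun M : ℕ => m - (m * Real.log K + 1) / Real.log M) atTop (𝓝 m) := by
      simpa using tendsto_const_nhds.sub (hlog.const_div_atTop (m * Real.log K + 1))
    have hbm : b.toReal < m := (ENNReal.toReal_lt_toReal hbt hνt).2 hbν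
    filter_upwards [hlim.eventually_const_lt hbm, hlog.eventually_gt_atTop 0,
      eventually_gt_atTop 0] with M h1 h2 h3
    have hM' : (0 : ℝ) < M := by exact_mod_cast h3
    have h4 := le_entropy_quantizedLaw hνμ hK hνK h3
    rw [ENNReal.lt_div_iff_mul_lt (Or.inl (by simpa using h2)) (Or.inl ENNReal.ofReal_ne_top)]
    rw [Real.log_div hM'.ne' hK.ne', ← ENNReal.ofReal_toReal hνt,
      ← ENNReal.ofReal_mul ENNReal.toReal_nonneg, ← hm] at h4
    have h5 : b.toReal * Real.log M + 1 < m * (Real.log M - Real.log K) := by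
      have := mul_lt_mul_of_pos_right h1 h2
      rw [sub_mul, div_mul_cancel₀ _ h2.ne'] at this
      linarith
    have h6 : b * ENNReal.ofReal (Real.log M) + 1 <
        ENNReal.ofReal (m * (Real.log M - Real.log K)) := by
      rw [← ENNReal.ofReal_toReal hbt, ← ENNReal.ofReal_mul ENNReal.toReal_nonneg,
        ← ENNReal.ofReal_one, ← ENNReal.ofReal_add (by positivity) zero_le_one]
      exact (ENNReal.ofReal_lt_ofReal_iff_of_nonneg (by positivity)).2 h5
    exact lt_of_add_lt_add_right (h6.trans_le h4)
  -- Upper bound: C does not depend on M, and it is finite because the entropy at scale 1 is.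
  · set C := entropy (quantizedLaw (μc + μd) 1) + S.card + S.card with hC
    have hCt : C ≠ ⊤ := by simp [hC, hH.ne]
    have hlim : Tendsto (fun M : ℕ => μc univ + C / ENNReal.ofReal (Real.log M)) atTop
        (𝓝 (μc univ + 0)) := by
      refine tendsto_const_nhds.add ?_
      have := ENNReal.Tendsto.const_div hlog' (Or.inr hCt)
      simpa using this
    rw [add_zero] at hlim
    filter_upwards [hlim.eventually_lt_const hb, hlog.eventually_gt_atTop 0,
      eventually_gt_atTop 0] with M h1 h2 h3
    refine lt_of_le_of_lt ?_ h1
    have h4 := entropy_quantizedLaw_le hμc hS h3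
    have h0 : ENNReal.ofReal (Real.log M) ≠ 0 := by simpa using h2
    calc _ ≤ (μc univ * ENNReal.ofReal (Real.log M) + C) / ENNReal.ofReal (Real.log M) :=
          ENNReal.div_le_div_right h4 _
      _ = _ := by
          rw [ENNReal.add_div, ENNReal.mul_div_cancel_right h0 ENNReal.ofReal_ne_top]

/-! ### The law of `f(Z)` -/

theorem PiecewiseSmooth.ae_mem_of_mem_flatSet {f : ℝ → ℝ} (hf : PiecewiseSmooth f) :
    ∃ S : Finset ℝ, ∀ᵐ x : ℝ, x ∈ flatSet f → f x ∈ S := by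
  classical
  obtain ⟨K, U, hU, -, hae, hk⟩ := hf.exists_open_pieces
  have hc : ∀ k, ∃ c : ℝ, InjOn f (U k) ∨ ∀ x ∈ U k, f x = c := by
    intro k
    rcases (hk k).2 with h | ⟨c, h⟩
    · exact ⟨0, Or.inl h⟩
    · exact ⟨c, Or.inr h⟩
  choose c hc using hc
  refine ⟨Finset.univ.image c, ?_⟩
  filter_upwards [hae] with x ⟨k, hxk⟩ hx
  rcases hc k with h | h
  · exact absurd hx (notMem_flatSet_of_injOn (hU k) h hxk)
  · rw [h x hxk]
    exact Finset.mem_image_of_mem _ (Finset.mem_univ k)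

/-- On an injective piece the change of variables formula equates the integral of |f'| over the
preimage of a null set with the measure of a null image. So f' = 0 almost everywhere on that
preimage, and `NonflatRegular` places such points in the flat set. -/
theorem PiecewiseSmooth.map_restrict_absolutelyContinuous {f : ℝ → ℝ} (hf : PiecewiseSmooth f)
    (hr : NonflatRegular f) : (gauss.restrict (flatSet f)ᶜ).map f ≪ volume := by
  obtain ⟨K, U, hU, -, hae, hk⟩ := hf.exists_open_pieces
  have hF := (isOpen_flatSet f).measurableSet
  refine Measure.AbsolutelyContinuous.mk fun N hN hN0 => ?_
  rw [Measure.map_apply hf.measurable hN, Measure.restrict_apply (hf.measurable hN)]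
  refine gaussianReal_absolutelyContinuous 0 one_ne_zero ?_
  have hpiece : ∀ k, ∀ᵐ x : ℝ, x ∈ U k → f x ∈ N → x ∈ flatSet f := by
    intro k
    rcases (hk k).2 with hi | ⟨c, hc⟩
    · have hs : MeasurableSet (U k ∩ f ⁻¹' N) := (hU k).measurableSet.inter (hf.measurable hN)
      have hd : ∀ x ∈ U k ∩ f ⁻¹' N, HasDerivWithinAt f (deriv f x) (U k ∩ f ⁻¹' N) x :=
        fun x hx => (((hk k).1.differentiableAt ((hU k).mem_nhds hx.1)).hasDerivAt).hasDerivWithinAt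
      have h0 := lintegral_image_eq_lintegral_abs_deriv_mul hs hd (hi.mono inter_subset_left)
        (fun _ => 1)
      have him : volume (f '' (U k ∩ f ⁻¹' N)) = 0 :=
        measure_mono_null (image_subset_iff.2 inter_subset_right) hN0
      simp only [mul_one, setLIntegral_const, him, mul_zero] at h0
      have h1 := (lintegral_eq_zero_iff (by fun_prop)).1 h0.symm
      have h2 := (ae_restrict_iff' hs).1 h1
      filter_upwards [h2, hr] with x hx hxr hxU hxN
      have h3 : deriv f x = 0 := by simpa using hx ⟨hxU, hxN⟩
      exact hxr h3
    · exact Eventually.of_forall fun x hx _ => mem_flatSet_of_const (hU k) hc hx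
  have hall : ∀ᵐ x : ℝ, x ∉ f ⁻¹' N ∩ (flatSet f)ᶜ := by
    filter_upwards [hae, ae_all_iff.2 hpiece] with x ⟨k, hxk⟩ hx h
    exact h.2 (hx k hxk h.1)
  exact measure_eq_zero_iff_ae_notMem.2 hall

theorem hasInfoDim_map {f : ℝ → ℝ} (hf : PiecewiseSmooth f) (hr : NonflatRegular f)
    (hH : entropy (quantizedLaw (gauss.map f) 1) < ⊤) :
    HasInfoDim (gauss.map f) (gauss (flatSet f)ᶜ) := by
  have hfm := hf.measurable
  have hF := (isOpen_flatSet f).measurableSet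
  obtain ⟨S, hS⟩ := hf.ae_mem_of_mem_flatSet
  have hsplit : gauss.map f =
      (gauss.restrict (flatSet f)ᶜ).map f + (gauss.restrict (flatSet f)).map f := by
    rw [← Measure.map_add _ _ hfm, add_comm, Measure.restrict_add_restrict_compl hF]
  have hp : IsProbabilityMeasure
      ((gauss.restrict (flatSet f)ᶜ).map f + (gauss.restrict (flatSet f)).map f) := by
    rw [← hsplit]
    exact Measure.isProbabilityMeasure_map hfm.aemeasurable
  have hSd : (gauss.restrict (flatSet f)).map f (S : Set ℝ)ᶜ = 0 := by
    have hm : MeasurableSet (S : Set ℝ)ᶜ := S.measurableSet.compl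
    rw [Measure.map_apply hfm hm, Measure.restrict_apply (hfm hm)]
    refine gaussianReal_absolutelyContinuous 0 one_ne_zero ?_
    refine measure_mono_null (fun x hx => ?_) (ae_iff.1 hS)
    exact fun h => hx.1 (h hx.2)
  have := hasInfoDim_add (hf.map_restrict_absolutelyContinuous hr) hSd (by rwa [← hsplit])
  rw [← hsplit, Measure.map_apply hfm MeasurableSet.univ, preimage_univ,
    Measure.restrict_apply_univ] at this
  exact this

end GLMEP
end

theorem mainTheorem1 (f : ℝ → ℝ) (hf : GLMEP.PiecewiseSmooth f)
    (hH : GLMEP.entropy (GLMEP.quantizedLaw ((gaussianReal 0 1).map f) 1) < ⊤) :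
    (∀ ν₁ ν₂ : Measure ℝ, GLMEP.IsEigenvalueLaw ν₁ → GLMEP.IsEigenvalueLaw ν₂ →
      GLMEP.Spikier ν₁ ν₂ → GLMEP.threshold f ν₁ ≤ GLMEP.threshold f ν₂) ∧
    (GLMEP.NonflatRegular f →
      ∃ d : ℝ≥0∞, GLMEP.HasInfoDim ((gaussianReal 0 1).map f) d ∧
        (GLMEP.mmseZ f 1 < 1 → d⁻¹ < ⊤ →
          ∀ ε : ℝ≥0∞, 0 < ε → ∃ ν : Measure ℝ, GLMEP.IsEigenvalueLaw ν ∧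
            (∃ a b p : ℝ, 0 < a ∧ a < b ∧ 0 < p ∧ p < 1 ∧
              ν = ENNReal.ofReal p • Measure.dirac a + ENNReal.ofReal (1 - p) • Measure.dirac b) ∧
            d⁻¹ ≤ GLMEP.threshold f ν ∧ GLMEP.threshold f ν < d⁻¹ + ε)) := by
  refine ⟨fun ν₁ ν₂ h₁ h₂ hs => GLMEP.threshold_le_of_spikier hf.measurable h₁ h₂ hs,
    fun hr => ⟨GLMEP.gauss (GLMEP.flatSet f)ᶜ, GLMEP.hasInfoDim_map hf hr hH,
      fun hm hd ε hε => ?_⟩⟩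
  obtain ⟨p, a, b, ha, hab, hp, hp1, hlt⟩ := GLMEP.exists_twoAtoms_threshold_lt hf hm hd hε
  have hlaw := GLMEP.isEigenvalueLaw_twoAtoms hp hp1 ha hab
  exact ⟨_, hlaw, ⟨a, b, p, ha, hab, hp, hp1, rfl⟩, GLMEP.le_threshold hf.measurable hlaw, hlt⟩
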